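/- **Conventions.** A relational language $L=\langle R_i:i\in I\rangle$ has relation symbols of arities $\mathrm{ar}(R_i)=n_i\ge 1$; it is *unary* if all $n_i=1$. Structures have non-empty domains. An embedding is an injection $f$ with $\langle x_1,\dots,x_{n_i}\rangle\in\rho_i\Leftrightarrow\langle f(x_1),\dots,f(x_{n_i})\rangle\in\sigma_i$ for all $i$; $\cong$ denotes isomorphism and $\mathbb X\rightleftarrows\mathbb Y$ means that each of $\mathbb X,\mathbb Y$ embeds in the other (both presuppose the same language). For a structure $\mathbb X$ with domain $X$, $\mathbb P(\mathbb X)=\{f[X]: f \text{ an embedding of } \mathbb X \text{ into } \mathbb X\}$, partially ordered by inclusion. For a partial order $\mathbb P$, let $p\le^*q$ iff $\forall r\le p\;\exists s\le r\; s\le q$; the separative quotient $\mathrm{sq}\,\mathbb P$ is the antisymmetric quotient of the preorder $\langle \mathbb P,\le^*\rangle$. For a separative partial order $\mathbb S$, $\mathrm{ro}\,\mathbb S$ is its Boolean completion. For structures $\mathbb X,\mathbb Y$ (with their languages) consider the conditions - $\sim_0$: $\mathbb X=\mathbb Y$ (same language, domain and relations); - $\sim_1$: $\mathbb P(\mathbb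 X)=\mathbb P(\mathbb Y)$ and $\mathbb X\cong\mathbb Y$; - $\sim_2$: $\mathbb P(\mathbb X)=\mathbb P(\mathbb Y)$ and $\mathbb X\rightleftarrows\mathbb Y$; - $\sim_3$: $\mathbb X\cong\mathbb Y$; - $\sim_4$: $\mathbb P(\mathbb X)=\mathbb P(\mathbb Y)$; - $\sim_5$: $\mathbb P(\mathbb X)\cong\mathbb P(\mathbb Y)$ and $\mathbb X\rightleftarrows\mathbb Y$; - $\sim_6$: $\mathbb P(\mathbb X)\cong\mathbb P(\mathbb Y)$; - $\sim_7$: $\mathrm{sq}\,\mathbb P(\mathbb X)\cong\mathrm{sq}\,\mathbb P(\mathbb Y)$ and $\mathbb X\rightleftarrows\mathbb Y$; - $\sim_8$: $\mathrm{sq}\,\mathbb P(\mathbb X)\cong\mathrm{sq}\,\mathbb P(\mathbb Y)$; - $\sim_9$: $\mathbb X\rightleftarrows\mathbb Y$; - $\sim_{10}$: $\mathrm{ro}\,\mathrm{sq}\,\mathbb P(\mathbb X)\cong\mathrm{ro}\,\mathrm{sq}\,\mathbb P(\mathbb Y)$ (for posets of copies this is the same as forcing equivalence); - $\sim_{11}$: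 the full relation; and the diagram with the fifteen arrows $a:0\to1$, $b:1\to2$, $c:1\to3$, $d:2\to4$, $e:2\to5$, $f:3\to5$, $g:4\to6$, $h:5\to6$, $i:5\to7$, $j:6\to8$, $k:7\to8$, $l:7\to9$, $m:8\to10$, $n:9\to10$, $o:10\to11$, where $p\to q$ stands for the implication $\mathbb X\sim_p\mathbb Y\Rightarrow\mathbb X\sim_q\mathbb Y$. **Theorem.** Let $L$ be a non-unary relational language and $\kappa$ an infinite cardinal. On the set $\mathrm{Mod}_L(\kappa)$ of all $L$-structures with domain $\kappa$ all fifteen implications $a$–$o$ hold, each of them is proper (its converse fails for some pair of structures in $\mathrm{Mod}_L(\kappa)$), and there are no other implications between these relations: if $p,q\le 11$ and $\mathbb X\sim_p\mathbb Y$ implies $\mathbb X\sim_q\mathbb Y$ for all $\mathbb X,\mathbb Y\in\mathrm{Mod}_L(\kappa)$, then $p=q$ or $q$ can be reached from $p$ along arrows of the diagram. The same holds for the relations $\sim_0,\dots,\sim_{11}$ on the class of all relational structures, in all relational languages. -/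

import Mathlib

universe u v w

/-! ### Separative quotient and Boolean completion of a partial order -/

/-- The underlying set of the separative modification of a partial order. -/
def SepMod (P : Type w) : Type w := P

/-- The separative modification: `p ≤* q` iff every `r ≤ p` has an extension `s ≤ r` with
`s ≤ q`. -/
instance SepMod.instPreorder (P : Type w) [PartialOrder P] : Preorder (SepMod P) where
  le p q := ∀ r : P, r ≤ (show P from p) → ∃ s : P, s ≤ r ∧ s ≤ (show P from q)
  le_refl _ r hr := ⟨r, le_rfl, hr⟩
  le_trans _ _ _ hpq hqt r hr := by
    obtain ⟨s, hsr, hsq⟩ := hpq r hr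
    obtain ⟨t, hts, htt⟩ := hqt s hsq
    exact ⟨t, hts.trans hsr, htt⟩

/-- The separative quotient `sq P`: the antisymmetric quotient of the separative modification,
with its induced partial order. -/
abbrev SepQuot (P : Type w) [PartialOrder P] : Type w :=
  Antisymmetrization (SepMod P) (· ≤ ·)

/-- The Boolean completion `ro P` of a (separative) partial order: the complete Boolean algebra of
regular open sets of `P`, where the open sets of `P` are its lower sets. A lower set `U` is regular
iff it equals its double pseudocomplement, the interior of its closure. -/
abbrev RegOpen (P : Type w) [PartialOrder P] : Type w :=
  Heyting.Regular (LowerSet P)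

/-! ### Relational structures and their posets of copies -/

/-- A relational language is unary iff all its relation symbols have arity `1`. -/
def FirstOrder.Language.IsUnary (L : FirstOrder.Language.{u, v}) : Prop :=
  ∀ n : ℕ, n ≠ 1 → IsEmpty (L.Relations n)

/-- The set `ℙ(X)` of copies of a structure inside itself: the images of its self-embeddings. As a
type it is partially ordered by inclusion. -/
def Copies (L : FirstOrder.Language.{u, v}) (X : Type w) (ρ : L.Structure X) : Set (Set X) :=
  {A | ∃ f : L.Embedding X X, Set.range f = A}

/-- Isomorphism of two `L`-structures. -/
def IsoStr (L : FirstOrder.Language.{u, v}) (X Y : Type w) (ρ : L.Structure X) (σ : L.Structure Y) : Prop :=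
  Nonempty (L.Equiv X Y)

/-- Equimorphism (bi-embeddability) of two `L`-structures. -/
def EquimorphicStr (L : FirstOrder.Language.{u, v}) (X Y : Type w) (ρ : L.Structure X) (σ : L.Structure Y) :
    Prop :=
  Nonempty (L.Embedding X Y) ∧ Nonempty (L.Embedding Y X)

/-- Isomorphism of partial orders. -/
def IsoPoset (P Q : Type w) [PartialOrder P] [PartialOrder Q] : Prop :=
  Nonempty (P ≃o Q)

/-- Isomorphism of the separative quotients. -/
def IsoSq (P Q : Type w) [PartialOrder P] [PartialOrder Q] : Prop :=
  Nonempty (SepQuot P ≃o SepQuot Q)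

/-- Isomorphism of the Boolean completions of the separative quotients. (An order isomorphism of
Boolean algebras is an isomorphism of Boolean algebras.) -/
def IsoRoSq (P Q : Type w) [PartialOrder P] [PartialOrder Q] : Prop :=
  Nonempty (RegOpen (SepQuot P) ≃o RegOpen (SepQuot Q))

/-! ### The twelve similarities on `Mod_L(X)` -/

/-- The similarities `∼₀, …, ∼₁₁` on the set of all `L`-structures with domain `X`. -/
def ModSim (L : FirstOrder.Language.{u, v}) (X : Type w) (k : Fin 12) (ρ σ : L.Structure X) : Prop :=
  match k with
  | 0 => ρ = σ
  | 1 => Copies L X ρ = Copies L X σ ∧ IsoStr L X X ρ σ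
  | 2 => Copies L X ρ = Copies L X σ ∧ EquimorphicStr L X X ρ σ
  | 3 => IsoStr L X X ρ σ
  | 4 => Copies L X ρ = Copies L X σ
  | 5 => IsoPoset (Copies L X ρ) (Copies L X σ) ∧ EquimorphicStr L X X ρ σ
  | 6 => IsoPoset (Copies L X ρ) (Copies L X σ)
  | 7 => IsoSq (Copies L X ρ) (Copies L X σ) ∧ EquimorphicStr L X X ρ σ
  | 8 => IsoSq (Copies L X ρ) (Copies L X σ)
  | 9 => EquimorphicStr L X X ρ σ
  | 10 => IsoRoSq (Copies L X ρ) (Copies L X σ)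
  | 11 => True

/-! ### The class of all relational structures -/

/-- A relational structure together with its language: a relational language whose symbols have
positive arities, a non-empty domain, and an interpretation of the language on it. -/
structure RelStr where
  lang : FirstOrder.Language.{u, v}
  relational : lang.IsRelational
  arity_pos : IsEmpty (lang.Relations 0)
  carrier : Type w
  nonempty : Nonempty carrier
  str : lang.Structure carrier

namespace RelStr

/-- The set of copies of a relational structure inside itself. -/
def copies (S : RelStr.{u, v, w}) : Set (Set S.carrier) :=
  Copies S.lang S.carrier S.str

/-- `ℙ(S) = ℙ(T)`. Since the domain is the largest copy, equality of the two sets of copies entails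
equality of the domains; along it the same subsets are copies. -/
def CopiesEq (S T : RelStr.{u, v, w}) : Prop :=
  ∃ h : S.carrier = T.carrier, ∀ A : Set S.carrier, A ∈ S.copies ↔ cast h '' A ∈ T.copies

/-- Isomorphism of structures; it entails that the languages are equal. -/
def Iso (S T : RelStr.{u, v, w}) : Prop :=
  ∃ h : S.lang = T.lang, IsoStr T.lang S.carrier T.carrier (h ▸ S.str) T.str

/-- Equimorphism of structures; it entails that the languages are equal. -/
def Equimorphic (S T : RelStr.{u, v, w}) : Prop :=
  ∃ h : S.lang = T.lang, EquimorphicStr T.lang S.carrier T.carrier (h ▸ S.str) T.str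

/-- The twelve similarities on the class of all relational structures (in all relational languages).
In the first one, equality comprises the languages, the domains and the interpretations. -/
def Sim (k : Fin 12) (S T : RelStr.{u, v, w}) : Prop :=
  match k with
  | 0 => S = T
  | 1 => CopiesEq S T ∧ Iso S T
  | 2 => CopiesEq S T ∧ Equimorphic S T
  | 3 => Iso S T
  | 4 => CopiesEq S T
  | 5 => IsoPoset S.copies T.copies ∧ Equimorphic S T
  | 6 => IsoPoset S.copies T.copies
  | 7 => IsoSq S.copies T.copies ∧ Equimorphic S T
  | 8 => IsoSq S.copies T.copies
  | 9 => Equimorphic S T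
  | 10 => IsoRoSq S.copies T.copies
  | 11 => True

end RelStr

/-! ### The diagram -/

/-- The fifteen arrows `a`–`o` of the diagram, between the numbers of the similarities. -/
inductive Arrow : Fin 12 → Fin 12 → Prop
  | a : Arrow 0 1
  | b : Arrow 1 2
  | c : Arrow 1 3
  | d : Arrow 2 4
  | e : Arrow 2 5
  | f : Arrow 3 5
  | g : Arrow 4 6
  | h : Arrow 5 6
  | i : Arrow 5 7
  | j : Arrow 6 8
  | k : Arrow 7 8
  | l : Arrow 7 9
  | m : Arrow 8 10
  | n : Arrow 9 10
  | o : Arrow 10 11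

/-- `sim` realizes the diagram exactly: every arrow is a valid implication, every arrow is proper
(its converse fails), and each valid implication between two of the relations is obtained from the
arrows by transitivity (or is trivial). -/
def RealizesDiagram {M : Type*} (sim : Fin 12 → M → M → Prop) : Prop :=
  (∀ p q, Arrow p q → ∀ x y, sim p x y → sim q x y) ∧
  (∀ p q, Arrow p q → ∃ x y, sim q x y ∧ ¬ sim p x y) ∧
  (∀ p q, (∀ x y, sim p x y → sim q x y) → Relation.ReflTransGen Arrow p q)

/-!
The fifteen implications are routine except for one: equimorphic structures `X` and `Y` have
isomorphic completions `ro sq ℙ(X)` and `ro sq ℙ(Y)`. A partial order and its separative quotient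
have the same regular open algebra (`SepQuot.nonempty_regOpen_orderIso`), and an embedding of `X`
into `Y` identifies `ro ℙ(X)` with a principal ideal of `ro ℙ(Y)`
(`EquimorphicStr.exists_regOpen_iso_Iic`). As the roles of `X` and `Y` can be exchanged, the
Cantor–Bernstein theorem for complete Boolean algebras (`BooleanAlgebra.cantorBernstein`) applies.

For the rest, it is enough to separate seven pairs of relations (`exists_separating_pair`), and
countable loopless binary relations suffice for this, whatever the language and the
infinite domain. Every infinite set carries a binary relation without non-trivial
self-embeddings, made from a complete well-order and a choice of an increasing sequence
converging to each of its points of countable cofinality (`StrictMono.eq_id_of_ladderStep`). In its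
disjoint sum with a loopless relation, all embeddings are the identity on the rigid part
(`isBinEmb_sumRel_iff`), so the sum inherits all similarities and dissimilarities of the
countable part. A symbol of arity at least two encodes the sum in a structure.

The countable relations are the following.
* `∼₁` but not `∼₀`: an edge on two points and its reverse.
* `∼₂` but not `∼₃`: the path on `ℕ` with the even and with the odd numbers marked; they embed in
  each other by odd shifts, while their self-embeddings are the even shifts.
* `∼₃` but not `∼₄`: an edge from `0` to `1` and one from `0` to `2`, on `ℕ`.
* `∼₄` but not `∼₉`: an edge on two points and the empty relation.
* `∼₇` but not `∼₆`: a path and its sum with an isolated point. In both cases any two copies have a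
  common subcopy, but only the copies of the path form a chain.
* `∼₉` but not `∼₈`: a binary tree and the sum of two of them. Compatible copies of the tree are
  comparable, which passes to the separative quotient and fails for the sum.
* `∼₁₁` but not `∼₁₀`: a path and a binary tree. The completion is trivial only for the path.
-/

/-! ### Regular open algebras and dense maps -/

theorem LowerSet.mem_heytingCompl {P : Type*} [PartialOrder P] {U : LowerSet P} {p : P} :
    p ∈ Uᶜ ↔ ∀ r ≤ p, r ∉ U := by
  rw [← LowerSet.Iic_le, le_compl_iff_disjoint_right, disjoint_iff_inf_le]
  constructor
  · intro h r hr hU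
    exact h (show r ∈ LowerSet.Iic p ⊓ U from ⟨hr, hU⟩)
  · rintro h r ⟨hr, hU⟩
    exact (h r hr hU).elim

/-- A lower set is regular iff it contains every point below which it is dense. -/
theorem LowerSet.isRegular_iff {P : Type*} [PartialOrder P] {U : LowerSet P} :
    Heyting.IsRegular U ↔ ∀ p, (∀ r ≤ p, ∃ s ≤ r, s ∈ U) → p ∈ U := by
  have key : ∀ p, p ∈ Uᶜᶜ ↔ ∀ r ≤ p, ∃ s ≤ r, s ∈ U := by
    intro p
    simp only [LowerSet.mem_heytingCompl]
    push Not
    rfl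
  rw [Heyting.IsRegular]
  constructor
  · intro h p hp
    rw [← h]
    exact (key p).2 hp
  · intro h
    ext p
    refine ⟨fun hp => h p ((key p).1 hp), fun hp => (key p).2 fun r hr => ⟨r, le_rfl, ?_⟩⟩
    exact U.lower hr hp

namespace RegOpen

variable {P Q : Type*} [PartialOrder P] [PartialOrder Q]

/-- The regular open set with a given underlying lower set. -/
def mk (U : LowerSet P) (h : ∀ p, (∀ r ≤ p, ∃ s ≤ r, s ∈ U) → p ∈ U) : RegOpen P :=
  ⟨U, LowerSet.isRegular_iff.2 h⟩

theorem mem_of_dense_below (U : RegOpen P) {p : P} (h : ∀ r ≤ p, ∃ s ≤ r, s ∈ U.val) :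
    p ∈ U.val :=
  LowerSet.isRegular_iff.1 U.prop p h

end RegOpen

/-- A map of partial orders that is monotone, reflects compatibility, and has an image that is
dense below each of its points. It identifies the regular open sets of its domain with those of
its codomain in which the image is dense. -/
structure IsLocallyDense {P Q : Type*} [PartialOrder P] [PartialOrder Q] (e : P → Q) : Prop where
  mono : Monotone e
  compat : ∀ p p' q, q ≤ e p → q ≤ e p' → ∃ s, s ≤ p ∧ s ≤ p'
  dense : ∀ p q, q ≤ e p → ∃ s, e s ≤ q

namespace IsLocallyDense

variable {P Q : Type*} [PartialOrder P] [PartialOrder Q] {e : P → Q}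

/-- The preimage of a regular open set under a locally dense map. -/
def pull (he : IsLocallyDense e) (U : RegOpen Q) : RegOpen P :=
  RegOpen.mk ⟨{p | e p ∈ U.val}, fun _ _ hba ha => U.val.lower (he.mono hba) ha⟩ <| by
    intro p hp
    refine U.mem_of_dense_below fun q hq => ?_
    obtain ⟨p₁, h₁⟩ := he.dense p q hq
    obtain ⟨r, hrp, hr₁⟩ := he.compat p p₁ (e p₁) (h₁.trans hq) le_rfl
    obtain ⟨s, hsr, hs⟩ := hp r hrp
    exact ⟨e s, (he.mono (hsr.trans hr₁)).trans h₁, hs⟩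

/-- The regular open set generated by the image of a regular open set. -/
def push (e : P → Q) (W : RegOpen P) : RegOpen Q :=
  RegOpen.mk ⟨{q | ∀ r ≤ q, ∃ p ∈ W.val, e p ≤ r}, fun _ _ hba ha r hr => ha r (hr.trans hba)⟩ <| by
    intro q hq r hr
    obtain ⟨s, hs, h⟩ := hq r hr
    obtain ⟨p, hp, hps⟩ := h s le_rfl
    exact ⟨p, hp, hps.trans hs⟩

theorem mem_push {W : RegOpen P} {q : Q} :
    q ∈ (push e W).val ↔ ∀ r ≤ q, ∃ p ∈ W.val, e p ≤ r := Iff.rfl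

theorem push_mono {W W' : RegOpen P} (h : W ≤ W') : push e W ≤ push e W' := by
  intro q hq r hr
  obtain ⟨p, hp, hpr⟩ := hq r hr
  exact ⟨p, h hp, hpr⟩

theorem pull_push (he : IsLocallyDense e) (W : RegOpen P) : he.pull (push e W) = W := by
  apply Heyting.Regular.coe_injective
  ext p
  change e p ∈ (push e W).val ↔ p ∈ W.val
  rw [mem_push]
  constructor
  · intro h
    refine W.mem_of_dense_below fun r hr => ?_
    obtain ⟨p', hp', hle⟩ := h (e r) (he.mono hr)
    obtain ⟨s, hs, hsr⟩ := he.compat p' r (e p') le_rfl hle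
    exact ⟨s, hsr, W.val.lower hs hp'⟩
  · intro hp r hr
    obtain ⟨p₁, h₁⟩ := he.dense p r hr
    obtain ⟨s, hs, hs₁⟩ := he.compat p p₁ (e p₁) (h₁.trans hr) le_rfl
    exact ⟨s, W.val.lower hs hp, (he.mono hs₁).trans h₁⟩

theorem push_pull (he : IsLocallyDense e) {U : RegOpen Q} (hU : U ≤ push e ⊤) :
    push e (he.pull U) = U := by
  apply Heyting.Regular.coe_injective
  ext q
  constructor
  · intro h
    refine U.mem_of_dense_below fun r hr => ?_
    obtain ⟨p, hp, hle⟩ := h r hr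
    exact ⟨e p, hle, hp⟩
  · intro hq r hr
    obtain ⟨p, -, hp⟩ := hU hq r hr
    exact ⟨p, U.val.lower (hp.trans hr) hq, hp⟩

/-- A locally dense map identifies the regular open algebra of its domain with a principal ideal of
the regular open algebra of its codomain. -/
def regOpenIso (he : IsLocallyDense e) : RegOpen P ≃o Set.Iic (push e (⊤ : RegOpen P)) where
  toFun W := ⟨push e W, push_mono le_top⟩
  invFun U := he.pull U.1
  left_inv W := he.pull_push W
  right_inv U := Subtype.ext (he.push_pull U.2)
  map_rel_iff' := by
    intro W W'
    refine ⟨fun h => ?_, fun h => push_mono h⟩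
    rw [← he.pull_push W, ← he.pull_push W']
    intro p hp
    exact h hp

theorem nonempty_orderIso_of_dense (he : IsLocallyDense e) (hd : ∀ q, ∃ p, e p ≤ q) :
    Nonempty (RegOpen P ≃o RegOpen Q) := by
  have htop : push e (⊤ : RegOpen P) = ⊤ := by
    refine top_unique fun q _ r _ => ?_
    obtain ⟨p, hp⟩ := hd r
    exact ⟨p, trivial, hp⟩
  have i := he.regOpenIso
  rw [htop] at i
  exact ⟨i.trans OrderIso.IicTop⟩

end IsLocallyDense

/-- The canonical map from a partial order to its separative quotient. -/
def SepQuot.mk {P : Type*} [PartialOrder P] (p : P) : SepQuot P :=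
  toAntisymmetrization (α := SepMod P) (· ≤ ·) p

theorem SepQuot.mk_le {P : Type*} [PartialOrder P] {p q : P} :
    SepQuot.mk p ≤ SepQuot.mk q ↔ ∀ r ≤ p, ∃ s ≤ r, s ≤ q :=
  Iff.rfl

theorem SepQuot.mk_surjective {P : Type*} [PartialOrder P] :
    Function.Surjective (SepQuot.mk : P → SepQuot P) :=
  fun q => Quotient.inductionOn' q fun p => ⟨p, rfl⟩

theorem SepQuot.mk_mono {P : Type*} [PartialOrder P] : Monotone (SepQuot.mk : P → SepQuot P) :=
  fun _ _ h => SepQuot.mk_le.2 fun r hr => ⟨r, le_rfl, hr.trans h⟩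

/-- Compatibility in the separative quotient comes from compatibility in the partial order. -/
theorem SepQuot.exists_le_of_le_mk {P : Type*} [PartialOrder P] {p p' : P} {q : SepQuot P}
    (h : q ≤ SepQuot.mk p) (h' : q ≤ SepQuot.mk p') : ∃ s, s ≤ p ∧ s ≤ p' := by
  obtain ⟨c, rfl⟩ := SepQuot.mk_surjective q
  obtain ⟨s, hs, hsp⟩ := SepQuot.mk_le.1 h c le_rfl
  obtain ⟨t, ht, htp⟩ := SepQuot.mk_le.1 h' s hs
  exact ⟨t, ht.trans hsp, htp⟩

theorem SepQuot.isLocallyDense_mk {P : Type*} [PartialOrder P] :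
    IsLocallyDense (SepQuot.mk : P → SepQuot P) where
  mono := SepQuot.mk_mono
  compat _ _ _ h h' := SepQuot.exists_le_of_le_mk h h'
  dense _ q _ := by
    obtain ⟨c, rfl⟩ := SepQuot.mk_surjective q
    exact ⟨c, le_rfl⟩

/-- A partial order and its separative quotient have the same Boolean completion. -/
theorem SepQuot.nonempty_regOpen_orderIso (P : Type*) [PartialOrder P] :
    Nonempty (RegOpen P ≃o RegOpen (SepQuot P)) :=
  SepQuot.isLocallyDense_mk.nonempty_orderIso_of_dense fun q => by
    obtain ⟨c, rfl⟩ := SepQuot.mk_surjective q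
    exact ⟨c, le_rfl⟩

theorem SepQuot.nonempty_orderIso {P Q : Type*} [PartialOrder P] [PartialOrder Q] (e : P ≃o Q) :
    Nonempty (SepQuot P ≃o SepQuot Q) := by
  let f : SepMod P →o SepMod Q :=
    { toFun := e
      monotone' := fun p q h r hr => by
        obtain ⟨s, hs, hsq⟩ := h (e.symm r) (e.symm_apply_le.2 hr)
        exact ⟨e s, e.le_symm_apply.1 hs, e.monotone hsq⟩ }
  let g : SepMod Q →o SepMod P :=
    { toFun := e.symm
      monotone' := fun p q h r hr => by
        obtain ⟨s, hs, hsq⟩ := h (e r) (e.le_symm_apply.1 hr)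
        exact ⟨e.symm s, e.symm_apply_le.2 hs, e.symm.monotone hsq⟩ }
  refine ⟨OrderIso.ofHomInv f.antisymmetrization g.antisymmetrization ?_ ?_⟩
  · ext q
    obtain ⟨c, rfl⟩ := SepQuot.mk_surjective q
    exact congrArg SepQuot.mk (e.apply_symm_apply c)
  · ext q
    obtain ⟨c, rfl⟩ := SepQuot.mk_surjective q
    exact congrArg SepQuot.mk (e.symm_apply_apply c)

theorem RegOpen.nonempty_orderIso {P Q : Type*} [PartialOrder P] [PartialOrder Q] (e : P ≃o Q) :
    Nonempty (RegOpen P ≃o RegOpen Q) := by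
  have he : IsLocallyDense e :=
    { mono := e.monotone
      compat := fun p p' q h h' => ⟨e.symm q, e.symm_apply_le.2 h, e.symm_apply_le.2 h'⟩
      dense := fun _ q _ => ⟨e.symm q, (e.apply_symm_apply q).le⟩ }
  exact he.nonempty_orderIso_of_dense fun q => ⟨e.symm q, (e.apply_symm_apply q).le⟩

/-! ### The Cantor–Bernstein theorem for complete Boolean algebras -/

/-- An order isomorphism onto an ideal `Iic b` restricts to the ideals below an element. -/
def OrderIso.iicRestrict {A B : Type*} [PartialOrder A] [PartialOrder B] {b : B}
    (e : A ≃o Set.Iic b) (x : A) : Set.Iic x ≃o Set.Iic (e x : B) where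
  toFun u := ⟨e u.1, e.monotone u.2⟩
  invFun v := ⟨e.symm ⟨v.1, le_trans v.2 (e x).2⟩, e.symm_apply_le.2 v.2⟩
  left_inv u := Subtype.ext (e.symm_apply_apply u.1)
  right_inv v := Subtype.ext <| by
    change (e (e.symm ⟨v.1, le_trans v.2 (e x).2⟩) : B) = v.1
    rw [e.apply_symm_apply]
  map_rel_iff' := by
    intro u v
    exact e.map_rel_iff

/-- A Boolean algebra is the product of the ideals below an element and below its complement. -/
def BooleanAlgebra.iicProdIso {A : Type*} [BooleanAlgebra A] (x : A) :
    A ≃o Set.Iic x × Set.Iic xᶜ where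
  toFun u := (⟨u ⊓ x, inf_le_right⟩, ⟨u ⊓ xᶜ, inf_le_right⟩)
  invFun v := v.1.1 ⊔ v.2.1
  left_inv u := by
    change u ⊓ x ⊔ u ⊓ xᶜ = u
    rw [← inf_sup_left, sup_compl_eq_top, inf_top_eq]
  right_inv := by
    rintro ⟨⟨v, hv⟩, ⟨w, hw⟩⟩
    have hv' : v ⊓ xᶜ = ⊥ := disjoint_iff.1 (disjoint_compl_right.mono_left hv)
    have hw' : w ⊓ x = ⊥ := disjoint_iff.1 (disjoint_compl_left.mono_left hw)
    ext
    · change (v ⊔ w) ⊓ x = v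
      rw [inf_sup_right, hw', sup_bot_eq, inf_eq_left.2 hv]
    · change (v ⊔ w) ⊓ xᶜ = w
      rw [inf_sup_right, hv', bot_sup_eq, inf_eq_left.2 hw]
  map_rel_iff' := by
    intro u v
    constructor
    · rintro ⟨h₁, h₂⟩
      have h₁' : u ⊓ x ≤ v ⊓ x := h₁
      have h₂' : u ⊓ xᶜ ≤ v ⊓ xᶜ := h₂
      calc u = u ⊓ x ⊔ u ⊓ xᶜ := by rw [← inf_sup_left, sup_compl_eq_top, inf_top_eq]
        _ ≤ v := sup_le (h₁'.trans inf_le_left) (h₂'.trans inf_le_left)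
    · intro h
      exact ⟨inf_le_inf_right x h, inf_le_inf_right xᶜ h⟩

/-- Two complete Boolean algebras, each isomorphic to a principal ideal of the other, are
isomorphic. Completeness of one of them is enough; it enters as the existence of fixed points of
monotone maps. -/
theorem BooleanAlgebra.cantorBernstein {A B : Type*} [BooleanAlgebra A] [BooleanAlgebra B]
    (hfix : ∀ F : A → A, Monotone F → ∃ x, F x = x) {a : A} {b : B}
    (φ : A ≃o Set.Iic b) (ψ : B ≃o Set.Iic a) : Nonempty (A ≃o B) := by
  -- The decomposition `x ⊔ xᶜ` of `A` has to correspond to the decomposition `φ x ⊔ (φ x)ᶜ` of `B`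
  -- under `φ` on the first part and under `ψ` on the second part.
  obtain ⟨x, hx⟩ := hfix (fun x => (ψ (φ x : B)ᶜ : A)ᶜ) fun x y h =>
    compl_le_compl (ψ.monotone (compl_le_compl (φ.monotone h)))
  have hx' : (ψ (φ x : B)ᶜ : A) = xᶜ := by
    rw [← compl_compl (ψ (φ x : B)ᶜ : A)]
    exact congrArg _ hx
  have i := ψ.iicRestrict (φ x : B)ᶜ
  rw [hx'] at i
  let j : Set.Iic x × Set.Iic xᶜ ≃o Set.Iic (φ x : B) × Set.Iic (φ x : B)ᶜ :=
    { Equiv.prodCongr (φ.iicRestrict x).toEquiv i.symm.toEquiv with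
      map_rel_iff' := and_congr (φ.iicRestrict x).map_rel_iff i.symm.map_rel_iff }
  exact ⟨(iicProdIso x).trans (j.trans (iicProdIso (φ x : B)).symm)⟩

theorem RegOpen.exists_fixedPoint {P : Type*} [PartialOrder P] (F : RegOpen P → RegOpen P)
    (hF : Monotone F) : ∃ x, F x = x := by
  let _ : CompleteLattice (RegOpen P) := Heyting.Regular.gi.liftCompleteLattice
  exact ⟨_, OrderHom.map_lfp ⟨F, hF⟩⟩

/-! ### Embeddings of relational structures -/

/-- A map between structures is an embedding as far as relation symbols are concerned: it is
injective, and preserves and reflects all relations. -/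
def IsRelEmb {L : FirstOrder.Language.{u, v}} {X Y : Type*} (ρ : L.Structure X)
    (σ : L.Structure Y) (f : X → Y) : Prop :=
  Function.Injective f ∧
    ∀ (n : ℕ) (R : L.Relations n) (v : Fin n → X), σ.RelMap R (f ∘ v) ↔ ρ.RelMap R v

namespace IsRelEmb

variable {L : FirstOrder.Language.{u, v}} {X Y Z : Type*} {ρ : L.Structure X} {σ : L.Structure Y}
  {τ : L.Structure Z}

theorem id : IsRelEmb ρ ρ (_root_.id : X → X) :=
  ⟨Function.injective_id, fun _ _ _ => Iff.rfl⟩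

theorem comp {g : Y → Z} {f : X → Y} (hg : IsRelEmb σ τ g) (hf : IsRelEmb ρ σ f) :
    IsRelEmb ρ τ (g ∘ f) :=
  ⟨hg.1.comp hf.1, fun n R v => (hg.2 n R (f ∘ v)).trans (hf.2 n R v)⟩

theorem of_comp {g : Y → Z} {f : X → Y} (hg : IsRelEmb σ τ g) (h : IsRelEmb ρ τ (g ∘ f)) :
    IsRelEmb ρ σ f :=
  ⟨h.1.of_comp, fun n R v => (hg.2 n R (f ∘ v)).symm.trans (h.2 n R v)⟩

theorem symm {e : X ≃ Y} (h : IsRelEmb ρ σ e) : IsRelEmb σ ρ e.symm := by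
  refine of_comp h ?_
  rw [show (e ∘ e.symm : Y → Y) = _root_.id from funext e.apply_symm_apply]
  exact id

/-- If an embedding maps into the image of another one, it factors through it. -/
theorem exists_factor {g : Y → Z} {f : X → Z} (hg : IsRelEmb σ τ g) (hf : IsRelEmb ρ τ f)
    (h : Set.range f ⊆ Set.range g) : ∃ k : X → Y, IsRelEmb ρ σ k ∧ g ∘ k = f := by
  choose k hk using fun x => h ⟨x, rfl⟩
  have hgk : g ∘ k = f := funext hk
  exact ⟨k, hg.of_comp (hgk ▸ hf), hgk⟩

end IsRelEmb

section Relational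

variable {L : FirstOrder.Language.{u, v}} {X Y : Type w} {ρ : L.Structure X} {σ : L.Structure Y}

theorem nonempty_embedding_iff (hL : L.IsRelational) :
    Nonempty (L.Embedding X Y) ↔ ∃ f : X → Y, IsRelEmb ρ σ f := by
  constructor
  · rintro ⟨f⟩
    exact ⟨f, f.injective, fun n R v => f.map_rel R v⟩
  · rintro ⟨f, hf⟩
    exact ⟨⟨⟨f, hf.1⟩, fun {n} g => ((hL n).false g).elim, fun {n} R v => hf.2 n R v⟩⟩

theorem mem_copies_iff (hL : L.IsRelational) {A : Set X} :
    A ∈ Copies L X ρ ↔ ∃ f : X → X, IsRelEmb ρ ρ f ∧ Set.range f = A := by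
  constructor
  · rintro ⟨f, hf⟩
    exact ⟨f, ⟨f.injective, fun n R v => f.map_rel R v⟩, hf⟩
  · rintro ⟨f, hf, hA⟩
    exact ⟨⟨⟨f, hf.1⟩, fun {n} g => ((hL n).false g).elim, fun {n} R v => hf.2 n R v⟩, hA⟩

theorem equimorphicStr_iff (hL : L.IsRelational) :
    EquimorphicStr L X Y ρ σ ↔ (∃ f : X → Y, IsRelEmb ρ σ f) ∧ ∃ g : Y → X, IsRelEmb σ ρ g :=
  and_congr (nonempty_embedding_iff hL) (nonempty_embedding_iff hL)

theorem isoStr_iff (hL : L.IsRelational) :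
    IsoStr L X Y ρ σ ↔ ∃ e : X ≃ Y, IsRelEmb ρ σ e := by
  constructor
  · rintro ⟨e⟩
    exact ⟨e.toEquiv, e.injective, fun n R v => e.map_rel R v⟩
  · rintro ⟨e, he⟩
    exact ⟨⟨e, fun {n} g => ((hL n).false g).elim, fun {n} R v => he.2 n R v⟩⟩

theorem IsoStr.equimorphicStr (hL : L.IsRelational) (h : IsoStr L X Y ρ σ) :
    EquimorphicStr L X Y ρ σ := by
  obtain ⟨e, he⟩ := (isoStr_iff hL).1 h
  exact (equimorphicStr_iff hL).2 ⟨⟨e, he⟩, ⟨e.symm, he.symm⟩⟩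

theorem IsoStr.isoPoset_copies (hL : L.IsRelational) (h : IsoStr L X Y ρ σ) :
    IsoPoset (Copies L X ρ) (Copies L Y σ) := by
  obtain ⟨e, he⟩ := (isoStr_iff hL).1 h
  have key : ∀ A, A ∈ Copies L X ρ ↔ Equiv.Set.congr e A ∈ Copies L Y σ := by
    intro A
    rw [mem_copies_iff hL, mem_copies_iff hL]
    constructor
    · rintro ⟨f, hf, rfl⟩
      refine ⟨e ∘ f ∘ e.symm, he.comp (hf.comp he.symm), ?_⟩
      rw [Set.range_comp, Set.range_comp, e.symm.surjective.range_eq, Set.image_univ]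
      rfl
    · rintro ⟨f, hf, h⟩
      refine ⟨e.symm ∘ f ∘ e, he.symm.comp (hf.comp he), ?_⟩
      rw [Set.range_comp, Set.range_comp, e.surjective.range_eq, Set.image_univ, h]
      exact e.symm_image_image A
  exact ⟨{ (Equiv.Set.congr e).subtypeEquiv key with
    map_rel_iff' := Set.image_subset_image_iff e.injective }⟩

/-- If `X` embeds into `Y` and `Y` into `X`, then the Boolean completion of `ℙ(X)` is a principal
ideal of that of `ℙ(Y)`. Both are compared with the family of those subsets of `Y` that contain an
image of `X`: the copies of `Y` are dense in it, and `ℙ(X)` is mapped into it by an embedding. -/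
theorem EquimorphicStr.exists_regOpen_iso_Iic (hL : L.IsRelational)
    (h : EquimorphicStr L X Y ρ σ) :
    ∃ b : RegOpen (Copies L Y σ), Nonempty (RegOpen (Copies L X ρ) ≃o Set.Iic b) := by
  obtain ⟨⟨f, hf⟩, ⟨g, hg⟩⟩ := (equimorphicStr_iff hL).1 h
  let M : Set (Set Y) := {S | ∃ k : X → Y, IsRelEmb ρ σ k ∧ Set.range k ⊆ S}
  have hM : ∀ S ∈ M, ∃ A ∈ Copies L Y σ, A ⊆ S := by
    rintro S ⟨k, hk, hkS⟩
    exact ⟨Set.range (k ∘ g), (mem_copies_iff hL).2 ⟨_, hk.comp hg, rfl⟩,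
      (Set.range_comp_subset_range g k).trans hkS⟩
  have hi : ∀ A ∈ Copies L Y σ, A ∈ M := by
    intro A hA
    obtain ⟨k, hk, rfl⟩ := (mem_copies_iff hL).1 hA
    exact ⟨k ∘ f, hk.comp hf, Set.range_comp_subset_range f k⟩
  have hj : ∀ A ∈ Copies L X ρ, f '' A ∈ M := by
    intro A hA
    obtain ⟨k, hk, rfl⟩ := (mem_copies_iff hL).1 hA
    exact ⟨f ∘ k, hf.comp hk, (Set.range_comp f k).subset⟩
  -- A member of `M` inside `f '' A` contains the image under `f` of a copy of `X` inside `A`.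
  have hback : ∀ S ∈ M, S ⊆ Set.range f → ∃ B ∈ Copies L X ρ, f '' B ⊆ S := by
    rintro S ⟨k, hk, hkS⟩ hS
    obtain ⟨m, hm, hfm⟩ := hf.exists_factor hk (hkS.trans hS)
    refine ⟨Set.range m, (mem_copies_iff hL).2 ⟨m, hm, rfl⟩, ?_⟩
    rw [← Set.range_comp, hfm]
    exact hkS
  let i : Copies L Y σ → M := fun A => ⟨A.1, hi A.1 A.2⟩
  let j : Copies L X ρ → M := fun A => ⟨f '' A.1, hj A.1 A.2⟩
  have hi' : IsLocallyDense i :=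
    { mono := fun _ _ h => h
      compat := fun A A' S h h' => by
        obtain ⟨B, hB, hBS⟩ := hM S.1 S.2
        exact ⟨⟨B, hB⟩, hBS.trans h, hBS.trans h'⟩
      dense := fun A S _ => by
        obtain ⟨B, hB, hBS⟩ := hM S.1 S.2
        exact ⟨⟨B, hB⟩, hBS⟩ }
  have hj' : IsLocallyDense j :=
    { mono := fun _ _ h => Set.image_mono h
      compat := fun A A' S h h' => by
        obtain ⟨B, hB, hBS⟩ := hback S.1 S.2 (Set.Subset.trans h (Set.image_subset_range f A.1))
        exact ⟨⟨B, hB⟩, (Set.image_subset_image_iff hf.1).1 (hBS.trans h),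
          (Set.image_subset_image_iff hf.1).1 (hBS.trans h')⟩
      dense := fun A S h => by
        obtain ⟨B, hB, hBS⟩ := hback S.1 S.2 (Set.Subset.trans h (Set.image_subset_range f A.1))
        exact ⟨⟨B, hB⟩, hBS⟩ }
  obtain ⟨I⟩ := hi'.nonempty_orderIso_of_dense fun S => by
    obtain ⟨B, hB, hBS⟩ := hM S.1 S.2
    exact ⟨⟨B, hB⟩, hBS⟩
  refine ⟨I.symm (IsLocallyDense.push j ⊤), ⟨hj'.regOpenIso.trans ?_⟩⟩
  exact (I.symm.trans (OrderIso.IicTop (α := RegOpen (Copies L Y σ))).symm).iicRestrict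
    (IsLocallyDense.push j ⊤)

/-- Equimorphic structures have forcing equivalent posets of copies. -/
theorem EquimorphicStr.isoRoSq (hL : L.IsRelational) (h : EquimorphicStr L X Y ρ σ) :
    IsoRoSq (Copies L X ρ) (Copies L Y σ) := by
  obtain ⟨b, ⟨φ⟩⟩ := h.exists_regOpen_iso_Iic hL
  obtain ⟨a, ⟨ψ⟩⟩ := EquimorphicStr.exists_regOpen_iso_Iic hL (And.symm h)
  obtain ⟨i⟩ := BooleanAlgebra.cantorBernstein RegOpen.exists_fixedPoint φ ψ
  obtain ⟨j⟩ := SepQuot.nonempty_regOpen_orderIso (Copies L X ρ)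
  obtain ⟨k⟩ := SepQuot.nonempty_regOpen_orderIso (Copies L Y σ)
  exact ⟨j.symm.trans (i.trans k)⟩

end Relational

theorem IsoPoset.isoSq {P Q : Type w} [PartialOrder P] [PartialOrder Q] (h : IsoPoset P Q) :
    IsoSq P Q :=
  h.elim SepQuot.nonempty_orderIso

theorem IsoSq.isoRoSq {P Q : Type w} [PartialOrder P] [PartialOrder Q] (h : IsoSq P Q) :
    IsoRoSq P Q :=
  h.elim RegOpen.nonempty_orderIso

theorem isoPoset_of_eq {X : Type w} {C D : Set (Set X)} (h : C = D) : IsoPoset C D :=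
  h ▸ ⟨OrderIso.refl _⟩

/-- All arrows of the diagram are valid implications on the structures with a given domain. -/
theorem ModSim.of_arrow {L : FirstOrder.Language.{u, v}} (hL : L.IsRelational) {X : Type w}
    {p q : Fin 12} (hpq : Arrow p q) {ρ σ : L.Structure X} (hp : ModSim L X p ρ σ) :
    ModSim L X q ρ σ := by
  cases hpq with
  | a =>
    have h : ρ = σ := hp
    subst h
    exact ⟨rfl, (isoStr_iff hL).2 ⟨Equiv.refl X, IsRelEmb.id⟩⟩
  | b => exact ⟨hp.1, IsoStr.equimorphicStr hL hp.2⟩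
  | c => exact hp.2
  | d => exact hp.1
  | e => exact ⟨isoPoset_of_eq hp.1, hp.2⟩
  | f => exact ⟨IsoStr.isoPoset_copies hL hp, IsoStr.equimorphicStr hL hp⟩
  | g => exact isoPoset_of_eq hp
  | h => exact hp.1
  | i => exact ⟨IsoPoset.isoSq hp.1, hp.2⟩
  | j => exact IsoPoset.isoSq hp
  | k => exact hp.1
  | l => exact hp.2
  | m => exact IsoSq.isoRoSq hp
  | n => exact EquimorphicStr.isoRoSq hL hp
  | o => trivial

namespace RelStr

theorem Iso.elim {S T : RelStr.{u, v, w}} (h : Iso S T) :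
    IsoPoset S.copies T.copies ∧ Equimorphic S T := by
  obtain ⟨L, hL, _, X, _, ρ⟩ := S
  obtain ⟨L', hL', _, Y, _, σ⟩ := T
  obtain ⟨hLL', h⟩ := h
  have hLL'' : L = L' := hLL'
  subst hLL''
  exact ⟨IsoStr.isoPoset_copies hL h, rfl, IsoStr.equimorphicStr hL h⟩

theorem Equimorphic.isoRoSq {S T : RelStr.{u, v, w}} (h : Equimorphic S T) :
    IsoRoSq S.copies T.copies := by
  obtain ⟨L, hL, _, X, _, ρ⟩ := S
  obtain ⟨L', hL', _, Y, _, σ⟩ := T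
  obtain ⟨hLL', h⟩ := h
  have hLL'' : L = L' := hLL'
  subst hLL''
  exact EquimorphicStr.isoRoSq hL h

theorem CopiesEq.isoPoset {S T : RelStr.{u, v, w}} (h : CopiesEq S T) :
    IsoPoset S.copies T.copies := by
  obtain ⟨L, hL, _, X, _, ρ⟩ := S
  obtain ⟨L', hL', _, Y, _, σ⟩ := T
  obtain ⟨h, hA⟩ := h
  dsimp only at h
  subst h
  refine isoPoset_of_eq (Set.ext fun A => (hA A).trans ?_)
  simp

theorem Iso.refl (S : RelStr.{u, v, w}) : Iso S S :=
  ⟨rfl, (isoStr_iff S.relational).2 ⟨Equiv.refl _, IsRelEmb.id⟩⟩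

theorem CopiesEq.refl (S : RelStr.{u, v, w}) : CopiesEq S S :=
  ⟨rfl, fun A => by simp⟩

/-- All arrows of the diagram are valid implications on the class of all relational structures. -/
theorem Sim.of_arrow {p q : Fin 12} (hpq : Arrow p q) {S T : RelStr.{u, v, w}} (hp : Sim p S T) :
    Sim q S T := by
  cases hpq with
  | a =>
    have h : S = T := hp
    subst h
    exact ⟨CopiesEq.refl S, Iso.refl S⟩
  | b => exact ⟨hp.1, (Iso.elim hp.2).2⟩
  | c => exact hp.2
  | d => exact hp.1
  | e => exact ⟨CopiesEq.isoPoset hp.1, hp.2⟩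
  | f => exact Iso.elim hp
  | g => exact CopiesEq.isoPoset hp
  | h => exact hp.1
  | i => exact ⟨IsoPoset.isoSq hp.1, hp.2⟩
  | j => exact IsoPoset.isoSq hp
  | k => exact hp.1
  | l => exact hp.2
  | m => exact IsoSq.isoRoSq hp
  | n => exact Equimorphic.isoRoSq hp
  | o => trivial

/-- On structures with the same language and domain, the similarities of relational structures are
those of the set of structures with that domain. -/
theorem sim_mk_iff {L : FirstOrder.Language.{u, v}} (hL : L.IsRelational)
    (h0 : IsEmpty (L.Relations 0)) {X : Type w} (hX : Nonempty X) (k : Fin 12)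
    (ρ σ : L.Structure X) :
    Sim k ⟨L, hL, h0, X, hX, ρ⟩ ⟨L, hL, h0, X, hX, σ⟩ ↔ ModSim L X k ρ σ := by
  have hC : CopiesEq ⟨L, hL, h0, X, hX, ρ⟩ ⟨L, hL, h0, X, hX, σ⟩ ↔
      Copies L X ρ = Copies L X σ := by
    constructor
    · rintro ⟨_, hA⟩
      refine Set.ext fun A => (hA A).trans ?_
      simp [copies]
    · intro h
      refine ⟨rfl, fun A => ?_⟩
      simp [copies, h]
  have hI : Iso ⟨L, hL, h0, X, hX, ρ⟩ ⟨L, hL, h0, X, hX, σ⟩ ↔ IsoStr L X X ρ σ :=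
    ⟨fun ⟨_, h⟩ => h, fun h => ⟨rfl, h⟩⟩
  have hE : Equimorphic ⟨L, hL, h0, X, hX, ρ⟩ ⟨L, hL, h0, X, hX, σ⟩ ↔
      EquimorphicStr L X X ρ σ :=
    ⟨fun ⟨_, h⟩ => h, fun h => ⟨rfl, h⟩⟩
  fin_cases k
  · change (RelStr.mk L hL h0 X hX ρ = RelStr.mk L hL h0 X hX σ) ↔ ρ = σ
    simp
  · exact and_congr hC hI
  · exact and_congr hC hE
  · exact hI
  · exact hC
  · exact and_congr Iff.rfl hE
  · exact Iff.rfl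
  · exact and_congr Iff.rfl hE
  · exact Iff.rfl
  · exact hE
  · exact Iff.rfl
  · exact Iff.rfl

end RelStr

/-! ### A rigid relation on a set of any infinite size -/

/-- A sequence in a linear order climbs to `a` iff it is strictly increasing with supremum `a`. -/
def IsLadder {ι : Type*} [LinearOrder ι] (a : ι) (s : ℕ → ι) : Prop :=
  StrictMono s ∧ IsLUB (Set.range s) a

open Classical in
/-- `LadderStep n i j`: the point `j` is the supremum of a strictly increasing sequence, and `i` is
the `n`-th term of the sequence of this kind that has been chosen for `j`. -/
def LadderStep {ι : Type*} [LinearOrder ι] (n : ℕ) (i j : ι) : Prop :=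
  ∃ h : ∃ s, IsLadder j s, h.choose n = i

/-- The relation on `ι × ℕ` whose self-embeddings are trivial when `ι` is a complete well-order.
The points `(i, 0)` carry loops and are ordered as in `ι`; an edge leads from `(i, n)` to
`(i, n + 1)`; and an edge from `(i, n + 1)` to `(j, 0)` says that `i` is the `n`-th term of the
ladder chosen for `j`. -/
def RigidRel {ι : Type*} [LinearOrder ι] : ι × ℕ → ι × ℕ → Prop
  | (i, m), (j, n + 1) => i = j ∧ n = m
  | (i, 0), (j, 0) => i ≤ j
  | (i, m + 1), (j, 0) => LadderStep m i j

/-- In a complete well-order, a strictly increasing map that preserves the chosen ladders is the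
identity. If it moved `i`, then the supremum `a` of the orbit of `i` would be a fixed point, as the
ladder of its image lies below `a`. So the map would fix all terms of the ladder of `a`,
among them points above `i`, which would bound the orbit of `i` strictly below `a`. -/
theorem StrictMono.eq_id_of_ladderStep {ι : Type*} [LinearOrder ι] [WellFoundedLT ι]
    (hsup : ∀ s : ℕ → ι, ∃ a, IsLUB (Set.range s) a) {F : ι → ι} (hF : StrictMono F)
    (hstep : ∀ n i j, LadderStep n i j → LadderStep n (F i) (F j)) : F = id := by
  by_contra hne
  obtain ⟨i, hi⟩ : ∃ i, F i ≠ i := by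
    by_contra! h
    exact hne (funext h)
  have hlt : i < F i := lt_of_le_of_ne hF.le_apply hi.symm
  have horb : StrictMono fun n => F^[n] i := by
    refine strictMono_nat_of_lt_succ fun n => ?_
    rw [Function.iterate_succ_apply]
    exact hF.iterate n hlt
  obtain ⟨a, ha⟩ := hsup fun n => F^[n] i
  have hex : ∃ s, IsLadder a s := ⟨_, horb, ha⟩
  obtain ⟨hmono, hlub⟩ : IsLadder a hex.choose := hex.choose_spec
  have hl : ∀ n, LadderStep n (F (hex.choose n)) (F a) := fun n => hstep n _ _ ⟨hex, rfl⟩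
  obtain ⟨hex', -⟩ := hl 0
  have hl' : ∀ n, hex'.choose n = F (hex.choose n) := fun n => (hl n).2
  have hlub' : IsLUB (Set.range hex'.choose) (F a) := hex'.choose_spec.2
  have hbelow : ∀ n, hex.choose n < a := fun n =>
    (hmono (Nat.lt_succ_self n)).trans_le (hlub.1 ⟨n + 1, rfl⟩)
  have hFa : F a = a := by
    refine le_antisymm (hlub'.2 ?_) hF.le_apply
    rintro _ ⟨n, rfl⟩
    rw [hl']
    obtain ⟨_, ⟨m, rfl⟩, hm⟩ := (lt_isLUB_iff ha).1 (hbelow n)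
    refine le_trans (hF hm).le (ha.1 ⟨m + 1, ?_⟩)
    exact Function.iterate_succ_apply' F m i
  have hfix : ∀ n, F (hex.choose n) = hex.choose n := by
    intro n
    have hch : ∀ b (h : ∃ s, IsLadder b s), b = a → h.choose = hex.choose := by
      rintro _ _ rfl
      rfl
    rw [← hl', hch _ hex' hFa]
  have hia : i < a := hlt.trans_le (ha.1 ⟨1, rfl⟩)
  obtain ⟨_, ⟨n, rfl⟩, hn⟩ := (lt_isLUB_iff hlub).1 hia
  have hbound : a ≤ hex.choose n := by
    refine ha.2 ?_
    rintro _ ⟨m, rfl⟩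
    calc F^[m] i ≤ F^[m] (hex.choose n) := (hF.iterate m).monotone hn.le
      _ = hex.choose n := Function.iterate_fixed (hfix n) m
  exact (hbelow n).not_ge hbound

/-! ### Disjoint sums with the rigid relation -/

/-- A map is an embedding of binary relations: injective, preserving and reflecting. -/
def IsBinEmb {S T : Type*} (σ : S → S → Prop) (τ : T → T → Prop) (f : S → T) : Prop :=
  Function.Injective f ∧ ∀ a b, τ (f a) (f b) ↔ σ a b

/-- The disjoint sum of the rigid relation on `ι × ℕ` and a relation on `T`. -/
def SumRel (ι : Type*) [LinearOrder ι] {T : Type*} (τ : T → T → Prop) :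
    (ι × ℕ) ⊕ T → (ι × ℕ) ⊕ T → Prop :=
  Sum.LiftRel RigidRel τ

/-- An embedding between disjoint sums of the rigid relation and loopless relations is the identity
on the rigid part: loops go to loops, which gives a strictly increasing map of `ι`, and the rest
of the rigid part is reached from the loops along edges. -/
theorem isBinEmb_sumRel_iff {ι : Type*} [LinearOrder ι] [WellFoundedLT ι]
    (hsup : ∀ s : ℕ → ι, ∃ a, IsLUB (Set.range s) a) {S T : Type*} {σ : S → S → Prop}
    {τ : T → T → Prop} (hτ : ∀ t, ¬ τ t t) {f : (ι × ℕ) ⊕ S → (ι × ℕ) ⊕ T} :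
    IsBinEmb (SumRel ι σ) (SumRel ι τ) f ↔ ∃ g, IsBinEmb σ τ g ∧ f = Sum.map id g := by
  constructor
  · rintro ⟨hinj, hrel⟩
    have h0 : ∀ i, ∃ j, f (.inl (i, 0)) = .inl (j, 0) := by
      intro i
      have h := (hrel (.inl (i, 0)) (.inl (i, 0))).2 (.inl le_rfl)
      rcases hfi : f (.inl (i, 0)) with ⟨j, _ | n⟩ | t
      · exact ⟨j, rfl⟩
      · rw [hfi] at h
        rcases h with ⟨-, h⟩
        omega
      · rw [hfi] at h
        cases h with
        | inr h => exact (hτ t h).elim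
    choose F hF0 using h0
    have hF : StrictMono F := by
      have hle : ∀ i j, F i ≤ F j ↔ i ≤ j := by
        intro i j
        have h := hrel (.inl (i, 0)) (.inl (j, 0))
        simpa [hF0, SumRel, RigidRel] using h
      exact strictMono_of_le_iff_le fun i j => (hle i j).symm
    have hFn : ∀ n i, f (.inl (i, n)) = .inl (F i, n) := by
      intro n
      induction n with
      | zero => exact hF0
      | succ n ih =>
        intro i
        have h := (hrel (.inl (i, n)) (.inl (i, n + 1))).2 (.inl ⟨rfl, rfl⟩)
        rw [ih] at h
        rcases hfi : f (.inl (i, n + 1)) with ⟨j, _ | m⟩ | t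
        · have hl := (hrel (.inl (i, n + 1)) (.inl (i, n + 1))).1
            (by rw [hfi]; exact .inl le_rfl)
          rcases hl with ⟨-, hl⟩
          omega
        · rw [hfi] at h
          rcases h with ⟨hij, hmn⟩
          rw [hij, hmn]
        · rw [hfi] at h
          cases h
    have hid : F = id := by
      refine hF.eq_id_of_ladderStep hsup fun n i j hij => ?_
      have h := (hrel (.inl (i, n + 1)) (.inl (j, 0))).2 (.inl hij)
      rw [hFn, hFn] at h
      cases h with
      | inl h => exact h
    have hl : ∀ r, f (.inl r) = .inl r := by
      rintro ⟨i, n⟩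
      rw [hFn, hid, id]
    have hr : ∀ s, ∃ t, f (.inr s) = .inr t := by
      intro s
      rcases hfs : f (.inr s) with r | t
      · have h : (Sum.inr s : (ι × ℕ) ⊕ S) = .inl r := hinj (hfs.trans (hl r).symm)
        cases h
      · exact ⟨t, rfl⟩
    choose g hg using hr
    refine ⟨g, ⟨fun a b hab => ?_, fun a b => ?_⟩, ?_⟩
    · exact Sum.inr_injective (hinj (by rw [hg, hg, hab]))
    · have h := hrel (.inr a) (.inr b)
      rw [hg, hg] at h
      simpa [SumRel] using h
    · funext x
      rcases x with r | s
      · exact hl r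
      · exact hg s
  · rintro ⟨g, hg, rfl⟩
    refine ⟨Function.injective_id.sumMap hg.1, ?_⟩
    rintro (a | a) (b | b)
    · simp [SumRel]
    · simp [SumRel]
    · simp [SumRel]
    · simpa [SumRel] using hg.2 a b

/-! ### Structures realizing a loopless binary relation -/

/-- The structure on `X` in which the symbol `R₀` is interpreted by a binary relation applied to
the first two entries of a tuple, and all other relations are empty. -/
@[reducible]
def binStr {L : FirstOrder.Language.{u, v}} (hL : L.IsRelational) {m : ℕ}
    (R₀ : L.Relations (m + 2)) {X : Type*} (r : X → X → Prop) : L.Structure X where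
  funMap {n} f := ((hL n).false f).elim
  RelMap {n} R v := ∃ h : n = m + 2, h ▸ R = R₀ ∧ r (v ⟨0, by omega⟩) (v ⟨1, by omega⟩)

theorem binStr_relMap {L : FirstOrder.Language.{u, v}} (hL : L.IsRelational) {m : ℕ}
    (R₀ : L.Relations (m + 2)) {X : Type*} (r : X → X → Prop) (v : Fin (m + 2) → X) :
    (binStr hL R₀ r).RelMap R₀ v ↔ r (v 0) (v 1) :=
  ⟨fun ⟨_, _, h⟩ => h, fun h => ⟨rfl, rfl, h⟩⟩

theorem binStr_apply {L : FirstOrder.Language.{u, v}} (hL : L.IsRelational) {m : ℕ}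
    (R₀ : L.Relations (m + 2)) {X : Type*} (r : X → X → Prop) (x y : X) :
    (binStr hL R₀ r).RelMap R₀ (Fin.cons x fun _ => y) ↔ r x y :=
  binStr_relMap hL R₀ r _

theorem binStr_injective {L : FirstOrder.Language.{u, v}} (hL : L.IsRelational) {m : ℕ}
    (R₀ : L.Relations (m + 2)) {X : Type*} :
    Function.Injective (binStr hL R₀ : (X → X → Prop) → L.Structure X) := by
  intro r r' h
  funext x y
  rw [← propext (binStr_apply hL R₀ r x y), ← propext (binStr_apply hL R₀ r' x y), h]

theorem isRelEmb_binStr_iff {L : FirstOrder.Language.{u, v}} (hL : L.IsRelational) {m : ℕ}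
    (R₀ : L.Relations (m + 2)) {X Y : Type*} {r : X → X → Prop} {s : Y → Y → Prop} {f : X → Y} :
    IsRelEmb (binStr hL R₀ r) (binStr hL R₀ s) f ↔ IsBinEmb r s f := by
  constructor
  · rintro ⟨hinj, hrel⟩
    refine ⟨hinj, fun a b => ?_⟩
    have h := hrel _ R₀ (Fin.cons a fun _ => b)
    rwa [binStr_relMap, binStr_relMap] at h
  · rintro ⟨hinj, hrel⟩
    refine ⟨hinj, fun n R v => ?_⟩
    exact exists_congr fun _ => and_congr_right fun _ => hrel _ _

theorem IsBinEmb.comp {R S T : Type*} {ρ : R → R → Prop} {σ : S → S → Prop} {τ : T → T → Prop}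
    {g : S → T} {f : R → S} (hg : IsBinEmb σ τ g) (hf : IsBinEmb ρ σ f) :
    IsBinEmb ρ τ (g ∘ f) :=
  ⟨hg.1.comp hf.1, fun a b => (hg.2 _ _).trans (hf.2 a b)⟩

/-- The images of the self-embeddings of a binary relation. -/
def BinCopies {T : Type*} (τ : T → T → Prop) : Set (Set T) :=
  {A | ∃ g, IsBinEmb τ τ g ∧ Set.range g = A}

/-- The data for realizing countable binary relations by structures with domain `X`: a relational
language with a symbol of arity at least two, and a complete well-order `ι` for the rigid part. -/
structure RealizeData (L : FirstOrder.Language.{u, v}) (X : Type w) where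
  relational : L.IsRelational
  m : ℕ
  symb : L.Relations (m + 2)
  ι : Type w
  order : LinearOrder ι
  wf : WellFoundedLT ι
  sup : ∀ s : ℕ → ι, ∃ a, IsLUB (Set.range s) a
  equiv : ∀ (T : Type) [Countable T], Nonempty ((ι × ℕ) ⊕ T ≃ X)

namespace RealizeData

attribute [instance] RealizeData.order RealizeData.wf

variable {L : FirstOrder.Language.{u, v}} {X : Type w} (D : RealizeData L X)

theorem nonempty_of_infinite {L : FirstOrder.Language.{u, v}} (hL : L.IsRelational) {m : ℕ}
    (R₀ : L.Relations (m + 2)) (X : Type w) [Infinite X] : Nonempty (RealizeData L X) := by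
  obtain ⟨_, _⟩ := exists_wellFoundedLT X
  refine ⟨⟨hL, m, R₀, WithTop X, inferInstance, inferInstance, fun s => ?_, fun T _ => ?_⟩⟩
  · have hne : (upperBounds (Set.range s)).Nonempty := ⟨⊤, fun _ _ => le_top⟩
    exact ⟨wellFounded_lt.min _ hne, wellFounded_lt.min_mem _ hne,
      fun b hb => wellFounded_lt.min_le hb⟩
  · have hX : Cardinal.aleph0 ≤ Cardinal.mk X := Cardinal.infinite_iff.1 inferInstance
    have hT : Cardinal.lift.{w} (Cardinal.mk T) ≤ Cardinal.mk X :=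
      (Cardinal.lift_le_aleph0.2 Cardinal.mk_le_aleph0).trans hX
    have hι : Cardinal.mk (WithTop X) = Cardinal.mk X :=
      Cardinal.mk_option.trans (Cardinal.add_one_of_aleph0_le hX)
    have h : Cardinal.mk ((WithTop X × ℕ) ⊕ T) = Cardinal.mk X := by
      rw [Cardinal.mk_sum, Cardinal.mk_prod, hι]
      simp only [Cardinal.lift_uzero, Cardinal.mk_nat, Cardinal.lift_aleph0]
      simp only [Cardinal.mk_mul_aleph0_eq]
      exact Cardinal.add_eq_left hX hT
    exact Cardinal.eq.1 h

/-- A bijection of the domain of the disjoint sum with `X`. -/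
noncomputable def e (T : Type) [Countable T] : (D.ι × ℕ) ⊕ T ≃ X :=
  (D.equiv T).some

/-- The structure on `X` that encodes the disjoint sum of the rigid relation and a given one. -/
@[reducible]
noncomputable def realize {T : Type} [Countable T] (τ : T → T → Prop) : L.Structure X :=
  binStr D.relational D.symb fun x y => SumRel D.ι τ ((D.e T).symm x) ((D.e T).symm y)

variable {S T : Type} [Countable S] [Countable T] {σ : S → S → Prop} {τ : T → T → Prop}

/-- The map of `X` induced by a map of the non-rigid parts. -/
noncomputable def lift (g : S → T) : X → X :=
  D.e T ∘ Sum.map id g ∘ (D.e S).symm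

theorem isRelEmb_realize_iff (hτ : ∀ t, ¬ τ t t) {f : X → X} :
    IsRelEmb (D.realize σ) (D.realize τ) f ↔ ∃ g, IsBinEmb σ τ g ∧ f = D.lift g := by
  rw [realize, realize, isRelEmb_binStr_iff]
  have h : IsBinEmb (fun x y => SumRel D.ι σ ((D.e S).symm x) ((D.e S).symm y))
      (fun x y => SumRel D.ι τ ((D.e T).symm x) ((D.e T).symm y)) f ↔
      IsBinEmb (SumRel D.ι σ) (SumRel D.ι τ) ((D.e T).symm ∘ f ∘ D.e S) := by
    constructor
    · rintro ⟨hinj, hrel⟩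
      refine ⟨(D.e T).symm.injective.comp (hinj.comp (D.e S).injective), fun a b => ?_⟩
      have h := hrel (D.e S a) (D.e S b)
      simpa using h
    · rintro ⟨hinj, hrel⟩
      refine ⟨?_, fun x y => ?_⟩
      · have h := ((D.e T).injective.comp hinj).comp (D.e S).symm.injective
        convert h
        funext x
        simp
      · have h := hrel ((D.e S).symm x) ((D.e S).symm y)
        simpa using h
  rw [h, isBinEmb_sumRel_iff D.sup hτ]
  refine exists_congr fun g => and_congr_right fun _ => ?_
  rw [lift, Equiv.symm_comp_eq, ← Function.comp_assoc, Equiv.eq_comp_symm]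

theorem lift_surjective_iff {g : S → T} :
    Function.Surjective (D.lift g) ↔ Function.Surjective g := by
  rw [lift, (D.e T).comp_surjective, (D.e S).symm.surjective_comp, Sum.map_surjective]
  exact and_iff_right Function.surjective_id

theorem equimorphicStr_realize_iff (hσ : ∀ t, ¬ σ t t) (hτ : ∀ t, ¬ τ t t) :
    EquimorphicStr L X X (D.realize σ) (D.realize τ) ↔
      (∃ g, IsBinEmb σ τ g) ∧ ∃ g, IsBinEmb τ σ g := by
  rw [equimorphicStr_iff D.relational]
  simp only [D.isRelEmb_realize_iff hτ, D.isRelEmb_realize_iff hσ]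
  constructor
  · rintro ⟨⟨_, g, hg, -⟩, ⟨_, g', hg', -⟩⟩
    exact ⟨⟨g, hg⟩, ⟨g', hg'⟩⟩
  · rintro ⟨⟨g, hg⟩, ⟨g', hg'⟩⟩
    exact ⟨⟨_, g, hg, rfl⟩, ⟨_, g', hg', rfl⟩⟩

theorem isoStr_realize_iff (hτ : ∀ t, ¬ τ t t) :
    IsoStr L X X (D.realize σ) (D.realize τ) ↔ ∃ g, IsBinEmb σ τ g ∧ Function.Surjective g := by
  rw [isoStr_iff D.relational]
  constructor
  · rintro ⟨e, he⟩
    obtain ⟨g, hg, heg⟩ := (D.isRelEmb_realize_iff hτ).1 he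
    exact ⟨g, hg, D.lift_surjective_iff.1 (heg ▸ e.surjective)⟩
  · rintro ⟨g, hg, hs⟩
    have he : IsRelEmb (D.realize σ) (D.realize τ) (D.lift g) :=
      (D.isRelEmb_realize_iff hτ).2 ⟨g, hg, rfl⟩
    exact ⟨Equiv.ofBijective (D.lift g) ⟨he.1, D.lift_surjective_iff.2 hs⟩, he⟩

/-- The subset of `X` that consists of the rigid part and a given subset of the other part. -/
noncomputable def liftSet (A : Set T) : Set X :=
  D.e T '' (Set.range Sum.inl ∪ Sum.inr '' A)

theorem liftSet_subset_iff {A B : Set T} : D.liftSet A ⊆ D.liftSet B ↔ A ⊆ B := by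
  rw [liftSet, liftSet, Set.image_subset_image_iff (D.e T).injective]
  constructor
  · intro h a ha
    rcases h (.inr ⟨a, ha, rfl⟩) with ⟨_, h⟩ | ⟨b, hb, h⟩
    · cases h
    · exact Sum.inr_injective h ▸ hb
  · intro h
    exact Set.union_subset_union_right _ (Set.image_mono h)

theorem range_lift (g : T → T) : Set.range (D.lift g) = D.liftSet (Set.range g) := by
  rw [lift, liftSet, Set.range_comp, Set.range_comp, Equiv.range_eq_univ, Set.image_univ]
  congr 1
  ext x
  rcases x with r | t <;> simp

theorem mem_copies_realize_iff (hτ : ∀ t, ¬ τ t t) {B : Set X} :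
    B ∈ Copies L X (D.realize τ) ↔ ∃ A ∈ BinCopies τ, D.liftSet A = B := by
  rw [mem_copies_iff D.relational]
  simp only [D.isRelEmb_realize_iff hτ]
  constructor
  · rintro ⟨_, ⟨g, hg, rfl⟩, rfl⟩
    exact ⟨_, ⟨g, hg, rfl⟩, (D.range_lift g).symm⟩
  · rintro ⟨_, ⟨g, hg, rfl⟩, rfl⟩
    exact ⟨_, ⟨g, hg, rfl⟩, D.range_lift g⟩

theorem copies_realize_eq_iff {τ' : T → T → Prop} (hτ : ∀ t, ¬ τ t t) (hτ' : ∀ t, ¬ τ' t t) :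
    Copies L X (D.realize τ) = Copies L X (D.realize τ') ↔ BinCopies τ = BinCopies τ' := by
  have hinj : Function.Injective (D.liftSet (T := T)) := fun A B h =>
    Set.Subset.antisymm (D.liftSet_subset_iff.1 h.subset) (D.liftSet_subset_iff.1 h.superset)
  have h : ∀ {τ : T → T → Prop}, (∀ t, ¬ τ t t) →
      Copies L X (D.realize τ) = D.liftSet '' BinCopies τ := fun hτ =>
    Set.ext fun B => D.mem_copies_realize_iff hτ
  rw [h hτ, h hτ', hinj.image_injective.eq_iff]

/-- The poset of copies of a relation is that of the structure realizing it. -/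
theorem nonempty_copies_realize_iso (hτ : ∀ t, ¬ τ t t) :
    Nonempty (BinCopies τ ≃o Copies L X (D.realize τ)) := by
  let f : BinCopies τ ↪o Copies L X (D.realize τ) :=
    OrderEmbedding.ofMapLEIff
      (fun A => ⟨D.liftSet A.1, (D.mem_copies_realize_iff hτ).2 ⟨A.1, A.2, rfl⟩⟩)
      fun A B => D.liftSet_subset_iff
  refine ⟨RelIso.ofSurjective f ?_⟩
  rintro ⟨B, hB⟩
  obtain ⟨A, hA, rfl⟩ := (D.mem_copies_realize_iff hτ).1 hB
  exact ⟨⟨A, hA⟩, rfl⟩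

theorem isoPoset_realize_iff (hσ : ∀ t, ¬ σ t t) (hτ : ∀ t, ¬ τ t t) :
    IsoPoset (Copies L X (D.realize σ)) (Copies L X (D.realize τ)) ↔
      Nonempty (BinCopies σ ≃o BinCopies τ) := by
  obtain ⟨i⟩ := D.nonempty_copies_realize_iso hσ
  obtain ⟨j⟩ := D.nonempty_copies_realize_iso hτ
  exact ⟨fun ⟨k⟩ => ⟨i.trans (k.trans j.symm)⟩, fun ⟨k⟩ => ⟨i.symm.trans (k.trans j)⟩⟩

theorem isoSq_realize_iff (hσ : ∀ t, ¬ σ t t) (hτ : ∀ t, ¬ τ t t) :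
    IsoSq (Copies L X (D.realize σ)) (Copies L X (D.realize τ)) ↔
      Nonempty (SepQuot (BinCopies σ) ≃o SepQuot (BinCopies τ)) := by
  obtain ⟨i⟩ := (D.nonempty_copies_realize_iso hσ).elim SepQuot.nonempty_orderIso
  obtain ⟨j⟩ := (D.nonempty_copies_realize_iso hτ).elim SepQuot.nonempty_orderIso
  exact ⟨fun ⟨k⟩ => ⟨i.trans (k.trans j.symm)⟩, fun ⟨k⟩ => ⟨i.symm.trans (k.trans j)⟩⟩

theorem isoRoSq_realize_iff (hσ : ∀ t, ¬ σ t t) (hτ : ∀ t, ¬ τ t t) :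
    IsoRoSq (Copies L X (D.realize σ)) (Copies L X (D.realize τ)) ↔
      Nonempty (RegOpen (SepQuot (BinCopies σ)) ≃o RegOpen (SepQuot (BinCopies τ))) := by
  obtain ⟨i⟩ := ((D.nonempty_copies_realize_iso hσ).elim SepQuot.nonempty_orderIso).elim
    RegOpen.nonempty_orderIso
  obtain ⟨j⟩ := ((D.nonempty_copies_realize_iso hτ).elim SepQuot.nonempty_orderIso).elim
    RegOpen.nonempty_orderIso
  exact ⟨fun ⟨k⟩ => ⟨i.trans (k.trans j.symm)⟩, fun ⟨k⟩ => ⟨i.symm.trans (k.trans j)⟩⟩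

theorem realize_injective :
    Function.Injective (D.realize : (T → T → Prop) → L.Structure X) := by
  intro τ τ' h
  have h' := binStr_injective D.relational D.symb h
  funext a b
  simpa [SumRel] using congrFun (congrFun h' (D.e T (.inr a))) (D.e T (.inr b))

end RealizeData

/-! ### Posets of copies of some countable relations -/

theorem binCopies_of_finite {T : Type*} [Finite T] (τ : T → T → Prop) :
    BinCopies τ = {Set.univ} := by
  ext A
  constructor
  · rintro ⟨g, hg, rfl⟩
    exact (Finite.surjective_of_injective hg.1).range_eq
  · rintro rfl
    exact ⟨id, ⟨Function.injective_id, fun _ _ => Iff.rfl⟩, Set.range_id⟩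

/-- The relation whose only edge leads from `a` to `b`. -/
def edge {T : Type*} (a b : T) (x y : T) : Prop := x = a ∧ y = b

theorem not_edge_self {T : Type*} {a b : T} (h : a ≠ b) (t : T) : ¬ edge a b t t :=
  fun ⟨h₁, h₂⟩ => h (h₁.symm.trans h₂)

theorem isBinEmb_edge_iff {T : Type*} {a b c d : T} {f : T → T} :
    IsBinEmb (edge a b) (edge c d) f ↔ Function.Injective f ∧ f a = c ∧ f b = d := by
  refine and_congr_right fun hf => ⟨fun h => (h a b).2 ⟨rfl, rfl⟩, ?_⟩
  rintro ⟨rfl, rfl⟩ x y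
  exact and_congr hf.eq_iff hf.eq_iff

/-- On the natural numbers, an edge from `0` to `1` and one from `0` to `2` have different
copies: the complement of `2` is a copy of the former only. -/
theorem binCopies_edge_ne : BinCopies (edge 0 1 : ℕ → ℕ → Prop) ≠ BinCopies (edge 0 2) := by
  intro h
  let f : ℕ → ℕ := fun n => if n < 2 then n else n + 1
  have hf : IsBinEmb (edge 0 1) (edge 0 1) f := by
    refine isBinEmb_edge_iff.2 ⟨fun a b hab => ?_, rfl, rfl⟩
    simp only [f] at hab
    split_ifs at hab <;> omega
  have hmem : Set.range f ∈ BinCopies (edge 0 2 : ℕ → ℕ → Prop) := h ▸ ⟨f, hf, rfl⟩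
  obtain ⟨g, hg, hgf⟩ := hmem
  have h2 : 2 ∈ Set.range f := hgf ▸ ⟨2, (isBinEmb_edge_iff.1 hg).2.2⟩
  obtain ⟨n, hn⟩ := h2
  simp only [f] at hn
  split_ifs at hn <;> omega

/-- The path on the natural numbers, in which the points with a property `p` are marked by a
symmetric pair of edges to the point two steps further. -/
def MarkedPath (p : ℕ → Prop) (a b : ℕ) : Prop :=
  b = a + 1 ∨ (b = a + 2 ∧ p a) ∨ (a = b + 2 ∧ p b)

theorem not_markedPath_self (p : ℕ → Prop) (n : ℕ) : ¬ MarkedPath p n n := by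
  simp [MarkedPath]

/-- The embeddings of marked paths are the shifts respecting the marks. -/
theorem isBinEmb_markedPath_iff {p q : ℕ → Prop} {f : ℕ → ℕ} :
    IsBinEmb (MarkedPath p) (MarkedPath q) f ↔ ∃ k, (∀ n, q (n + k) ↔ p n) ∧ f = (· + k) := by
  have hstep : ∀ (p : ℕ → Prop) a b, MarkedPath p a b ∧ ¬ MarkedPath p b a ↔ b = a + 1 := by
    intro p a b
    unfold MarkedPath
    constructor
    · rintro ⟨h | ⟨h, hp⟩ | ⟨h, hp⟩, h'⟩
      · exact h
      · exact (h' (.inr (.inr ⟨h, hp⟩))).elim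
      · exact (h' (.inr (.inl ⟨h, hp⟩))).elim
    · intro h
      refine ⟨.inl h, ?_⟩
      rintro (h' | ⟨h', -⟩ | ⟨h', -⟩) <;> omega
  have hmark : ∀ (p : ℕ → Prop) a, MarkedPath p a (a + 2) ↔ p a := by
    intro p a
    refine ⟨?_, fun h => .inr (.inl ⟨rfl, h⟩)⟩
    rintro (h | ⟨-, h⟩ | ⟨h, -⟩)
    · omega
    · exact h
    · omega
  constructor
  · rintro ⟨hinj, hrel⟩
    have hf : ∀ n, f n = n + f 0 := by
      intro n
      induction n with
      | zero => simp
      | succ n ih =>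
        have h := (hstep p n (n + 1)).2 rfl
        rw [← hrel, ← hrel, hstep q] at h
        omega
    refine ⟨f 0, fun n => ?_, funext hf⟩
    rw [← hmark p n, ← hrel, hf n, hf (n + 2), ← hmark q]
    rw [show n + 2 + f 0 = n + f 0 + 2 by omega]
  · rintro ⟨k, hk, rfl⟩
    refine ⟨add_left_injective k, fun a b => ?_⟩
    unfold MarkedPath
    rw [hk, hk]
    dsimp only
    rw [show b + k = a + k + 1 ↔ b = a + 1 by omega, show b + k = a + k + 2 ↔ b = a + 2 by omega,
      show a + k = b + k + 2 ↔ a = b + 2 by omega]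

/-- The paths with the even and with the odd numbers marked have the same copies, as the even
shifts are the self-embeddings of both. -/
theorem binCopies_markedPath_even_odd :
    BinCopies (MarkedPath Even) = BinCopies (MarkedPath Odd) := by
  have h : ∀ k, (∀ n, Even (n + k) ↔ Even n) ↔ ∀ n, Odd (n + k) ↔ Odd n := fun k =>
    forall_congr' fun n => by rw [← Nat.not_even_iff_odd, ← Nat.not_even_iff_odd, not_iff_not]
  simp only [BinCopies, isBinEmb_markedPath_iff, h]

theorem exists_isBinEmb_markedPath_even_odd :
    (∃ g, IsBinEmb (MarkedPath Even) (MarkedPath Odd) g) ∧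
      ∃ g, IsBinEmb (MarkedPath Odd) (MarkedPath Even) g :=
  ⟨⟨_, isBinEmb_markedPath_iff.2 ⟨1, fun n => by grind, rfl⟩⟩,
    ⟨_, isBinEmb_markedPath_iff.2 ⟨1, fun n => by grind, rfl⟩⟩⟩

theorem not_exists_iso_markedPath_even_odd :
    ¬ ∃ g, IsBinEmb (MarkedPath Even) (MarkedPath Odd) g ∧ Function.Surjective g := by
  rintro ⟨g, hg, hs⟩
  obtain ⟨k, hk, rfl⟩ := isBinEmb_markedPath_iff.1 hg
  obtain ⟨n, hn⟩ := hs 0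
  have hk0 : k = 0 := by
    dsimp only at hn
    omega
  subst hk0
  exact absurd ((hk 0).2 (by simp)) (by simp)

/-- The disjoint sum of the isolated point `0` and the path on the positive integers. -/
def PointedPath (a b : ℕ) : Prop := b = a + 1 ∧ a ≠ 0

theorem not_pointedPath_self (n : ℕ) : ¬ PointedPath n n := by
  simp [PointedPath]

theorem exists_isBinEmb_path_pointedPath :
    (∃ g, IsBinEmb (MarkedPath fun _ => False) PointedPath g) ∧
      ∃ g, IsBinEmb PointedPath (MarkedPath fun _ => False) g := by
  refine ⟨⟨(· + 1), add_left_injective 1, fun a b => ?_⟩,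
    ⟨fun n => if n = 0 then 0 else n + 1, fun a b hab => ?_, fun a b => ?_⟩⟩
  · simp [PointedPath, MarkedPath]
  · dsimp only at hab
    split_ifs at hab <;> omega
  · simp only [PointedPath, MarkedPath, and_false, or_false]
    grind

/-- The copies of a path form a chain. -/
theorem binCopies_path_total (A B : BinCopies (MarkedPath fun _ => False)) : A ≤ B ∨ B ≤ A := by
  have key : ∀ A ∈ BinCopies (MarkedPath fun _ => False), ∃ k, A = Set.Ici k := by
    rintro _ ⟨g, hg, rfl⟩
    obtain ⟨k, -, rfl⟩ := isBinEmb_markedPath_iff.1 hg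
    refine ⟨k, Set.ext fun n => ?_⟩
    simp [le_iff_exists_add', eq_comm]
  obtain ⟨A, hA⟩ := A
  obtain ⟨B, hB⟩ := B
  obtain ⟨k, rfl⟩ := key A hA
  obtain ⟨l, rfl⟩ := key B hB
  rcases le_total k l with h | h
  · exact .inr (Set.Ici_subset_Ici.2 h)
  · exact .inl (Set.Ici_subset_Ici.2 h)

/-- The map that sends the isolated point to `j`, and the path to the path beyond `k`. -/
def pointedShift (j k n : ℕ) : ℕ := if n = 0 then j else n + k

theorem isBinEmb_pointedShift {j k : ℕ} (h : j ≤ k) (hj : j = 0 ∨ j < k) :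
    IsBinEmb PointedPath PointedPath (pointedShift j k) := by
  refine ⟨fun a b hab => ?_, fun a b => ?_⟩
  · simp only [pointedShift] at hab
    split_ifs at hab <;> omega
  · simp only [pointedShift, PointedPath]
    split_ifs <;> omega

theorem binCopies_pointedPath_not_total :
    ¬ ∀ A B : BinCopies PointedPath, A ≤ B ∨ B ≤ A := by
  intro h
  have h0 := isBinEmb_pointedShift (j := 0) (k := 3) (by omega) (by omega)
  have h1 := isBinEmb_pointedShift (j := 1) (k := 3) (by omega) (by omega)
  rcases h ⟨_, _, h0, rfl⟩ ⟨_, _, h1, rfl⟩ with h | h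
  all_goals
    obtain ⟨n, hn⟩ := h ⟨0, rfl⟩
    simp only [pointedShift] at hn
    grind

/-- Any two copies of a path with an isolated point have a common subcopy, as a copy contains all
sufficiently large numbers. -/
theorem binCopies_pointedPath_directed (A B : BinCopies PointedPath) : ∃ C, C ≤ A ∧ C ≤ B := by
  have key : ∀ A ∈ BinCopies PointedPath, ∃ k, ∀ n, k ≤ n → n ∈ A := by
    rintro _ ⟨g, ⟨-, hrel⟩, rfl⟩
    have hg : ∀ n, g (n + 1) = n + g 1 := by
      intro n
      induction n with
      | zero => simp
      | succ n ih =>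
        have h := ((hrel (n + 1) (n + 1 + 1)).2 ⟨rfl, by omega⟩).1
        omega
    refine ⟨g 1, fun n hn => ⟨n - g 1 + 1, ?_⟩⟩
    rw [hg]
    omega
  obtain ⟨k, hk⟩ := key A.1 A.2
  obtain ⟨l, hl⟩ := key B.1 B.2
  have h := isBinEmb_pointedShift (j := k + l) (k := k + l + 1) (by omega) (by omega)
  have hle : ∀ n, k + l ≤ pointedShift (k + l) (k + l + 1) n := by
    intro n
    simp only [pointedShift]
    split_ifs <;> omega
  refine ⟨⟨_, _, h, rfl⟩, ?_, ?_⟩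
  · rintro _ ⟨n, rfl⟩
    exact hk _ (by have := hle n; omega)
  · rintro _ ⟨n, rfl⟩
    exact hl _ (by have := hle n; omega)

/-! ### The binary tree -/

/-- The binary tree, a word being extended at its head. Edges lead from a word to its extension by
`false`, and in both directions between the two immediate extensions of a word. -/
def TreeRel (a b : List Bool) : Prop :=
  b = false :: a ∨ ∃ c, (a = false :: c ∧ b = true :: c) ∨ (a = true :: c ∧ b = false :: c)

theorem not_treeRel_self (a : List Bool) : ¬ TreeRel a a := by
  rintro (h | ⟨c, ⟨h, h'⟩ | ⟨h, h'⟩⟩)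
  · simpa using congrArg List.length h
  · simp [h] at h'
  · simp [h] at h'

theorem treeRel_left_iff {a b : List Bool} : TreeRel a b ∧ ¬ TreeRel b a ↔ b = false :: a := by
  constructor
  · rintro ⟨h | ⟨c, h⟩, h'⟩
    · exact h
    · exact (h' (.inr ⟨c, h.symm.imp And.symm And.symm⟩)).elim
  · rintro rfl
    refine ⟨.inl rfl, ?_⟩
    rintro (h | ⟨c, ⟨h, h'⟩ | ⟨h, h'⟩⟩)
    · have := congrArg List.length h
      simp only [List.length_cons] at this
      omega
    · simp only [List.cons.injEq, true_and] at h
      subst h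
      simpa using congrArg List.length h'
    · simp at h

theorem treeRel_symm_iff {a b : List Bool} :
    TreeRel (false :: a) b ∧ TreeRel b (false :: a) ↔ b = true :: a := by
  constructor
  · rintro ⟨h, h'⟩
    rcases h with rfl | ⟨c, ⟨h, h₁⟩ | ⟨h, h₁⟩⟩
    · exact ((treeRel_left_iff.2 rfl).2 h').elim
    · rw [h₁, (List.cons.inj h).2]
    · simp at h
  · rintro rfl
    exact ⟨.inr ⟨a, .inl ⟨rfl, rfl⟩⟩, .inr ⟨a, .inr ⟨rfl, rfl⟩⟩⟩

/-- An embedding of the tree is determined by the image of the root. -/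
theorem isBinEmb_treeRel_eq {f : List Bool → List Bool} (hf : IsBinEmb TreeRel TreeRel f) :
    f = (· ++ f []) := by
  funext s
  induction s with
  | nil => rfl
  | cons b s ih =>
    have h0 : f (false :: s) = false :: f s := by
      have h := treeRel_left_iff.2 (rfl : false :: s = false :: s)
      rwa [← hf.2, ← hf.2 (false :: s), treeRel_left_iff] at h
    cases b with
    | false =>
      rw [h0, ih]
      rfl
    | true =>
      have h := treeRel_symm_iff.2 (rfl : true :: s = true :: s)
      rw [← hf.2, ← hf.2 (true :: s), h0, treeRel_symm_iff] at h
      rw [h, ih]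
      rfl

theorem treeRel_append_iff (t : List Bool) {a b : List Bool} :
    TreeRel (a ++ t) (b ++ t) ↔ TreeRel a b := by
  constructor
  · rintro (h | ⟨c, ⟨h, h'⟩ | ⟨h, h'⟩⟩)
    · exact .inl (List.append_cancel_right h)
    all_goals
      rcases a with _ | ⟨x, a⟩
      · rcases b with _ | ⟨y, b⟩
        · rw [h] at h'
          simp at h'
        · simp only [List.nil_append] at h
          have := congrArg List.length h'
          simp only [h, List.length_append, List.length_cons] at this
          omega
      · rcases b with _ | ⟨y, b⟩
        · simp only [List.nil_append] at h'
          have := congrArg List.length h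
          simp only [h', List.length_append, List.length_cons] at this
          omega
        · simp only [List.cons_append, List.cons.injEq] at h h'
          obtain ⟨rfl, h⟩ := h
          obtain ⟨rfl, h'⟩ := h'
          have hab := List.append_cancel_right (h.trans h'.symm)
          subst hab
          first
          | exact .inr ⟨a, .inl ⟨rfl, rfl⟩⟩
          | exact .inr ⟨a, .inr ⟨rfl, rfl⟩⟩
  · rintro (h | ⟨c, ⟨h, h'⟩ | ⟨h, h'⟩⟩)
    · exact .inl (by rw [h]; rfl)
    · exact .inr ⟨c ++ t, .inl ⟨by rw [h]; rfl, by rw [h']; rfl⟩⟩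
    · exact .inr ⟨c ++ t, .inr ⟨by rw [h]; rfl, by rw [h']; rfl⟩⟩

theorem isBinEmb_append (t : List Bool) : IsBinEmb TreeRel TreeRel (· ++ t) :=
  ⟨fun _ _ h => List.append_cancel_right h, fun _ _ => treeRel_append_iff t⟩

/-- Compatible copies of the tree are comparable. -/
theorem binCopies_treeRel_comparable (A B C : BinCopies TreeRel) (hA : C ≤ A) (hB : C ≤ B) :
    A ≤ B ∨ B ≤ A := by
  obtain ⟨_, f, hf, rfl⟩ := A
  obtain ⟨_, g, hg, rfl⟩ := B
  obtain ⟨_, k, hk, rfl⟩ := C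
  have hle : ∀ {f g : List Bool → List Bool}, IsBinEmb TreeRel TreeRel f →
      IsBinEmb TreeRel TreeRel g → f [] <:+ g [] → Set.range g ⊆ Set.range f := by
    rintro f g hf hg ⟨t, ht⟩ _ ⟨s, rfl⟩
    refine ⟨s ++ t, ?_⟩
    rw [isBinEmb_treeRel_eq hf, isBinEmb_treeRel_eq hg]
    dsimp only
    rw [List.append_assoc, ht]
  obtain ⟨s, hs⟩ := hA ⟨[], rfl⟩
  obtain ⟨t, ht⟩ := hB ⟨[], rfl⟩
  rw [isBinEmb_treeRel_eq hf] at hs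
  rw [isBinEmb_treeRel_eq hg] at ht
  rcases List.suffix_or_suffix_of_suffix ⟨s, hs⟩ ⟨t, ht⟩ with h | h
  · exact .inr (hle hf hg h)
  · exact .inl (hle hg hf h)

/-- Two disjoint copies of the binary tree. -/
def TwoTreesRel (a b : Bool × List Bool) : Prop := a.1 = b.1 ∧ TreeRel a.2 b.2

theorem not_twoTreesRel_self (a : Bool × List Bool) : ¬ TwoTreesRel a a :=
  fun h => not_treeRel_self _ h.2

theorem isBinEmb_prodMk (b : Bool) : IsBinEmb TreeRel TwoTreesRel (Prod.mk b) :=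
  ⟨Prod.mk_right_injective b, fun _ _ => by simp [TwoTreesRel]⟩

theorem treeRel_cons_cons_append {x y : Bool} {s t : List Bool}
    (h : TreeRel (s ++ [x, x]) (t ++ [y, y])) : x = y := by
  have hl : ∀ (x : Bool) (s : List Bool), (s ++ [x, x]).getLast? = some x := by simp
  rcases h with h | ⟨c, h⟩
  · have h' := hl y t
    rw [h, ← List.singleton_append, ← List.append_assoc, hl] at h'
    exact Option.some.inj h'
  · have key : ∀ {z x : Bool} {s c : List Bool}, s ++ [x, x] = z :: c → c.getLast? = some x := by
      intro z x s c h
      have hx := hl x s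
      rcases c with _ | ⟨d, c⟩
      · simpa using congrArg List.length h
      · rwa [h, List.getLast?_cons_cons] at hx
    have h' : c.getLast? = some x ∧ c.getLast? = some y := by
      rcases h with ⟨h, h'⟩ | ⟨h, h'⟩ <;> exact ⟨key h, key h'⟩
    exact Option.some.inj (h'.1.symm.trans h'.2)

/-- Two disjoint trees are embedded in one above two incomparable words, which are so long that no
edge leads from one image to the other. -/
theorem isBinEmb_twoTreesRel :
    IsBinEmb TwoTreesRel TreeRel fun a => a.2 ++ [a.1, a.1] := by
  constructor
  · rintro ⟨x, s⟩ ⟨y, t⟩ h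
    have h' := congrArg List.getLast? h
    simp only [List.getLast?_append, List.getLast?_cons_cons, List.getLast?_singleton,
      Option.some_or, Option.some.injEq] at h'
    subst h'
    exact congrArg (Prod.mk _) (List.append_cancel_right h)
  · rintro ⟨x, s⟩ ⟨y, t⟩
    constructor
    · intro h
      have hxy := treeRel_cons_cons_append h
      subst hxy
      exact ⟨rfl, (treeRel_append_iff _).1 h⟩
    · rintro ⟨rfl, h⟩
      exact (treeRel_append_iff _).2 h

/-- The embedding of two trees in themselves that raises the first tree above a given word. -/
theorem isBinEmb_twoTreesRel_raise (t : List Bool) :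
    IsBinEmb TwoTreesRel TwoTreesRel fun a => (a.1, a.2 ++ if a.1 then [] else t) := by
  constructor
  · rintro ⟨x, s⟩ ⟨y, t⟩ h
    obtain ⟨rfl, h⟩ := Prod.mk.inj h
    exact congrArg (Prod.mk _) (List.append_cancel_right h)
  · rintro ⟨x, s⟩ ⟨y, t⟩
    refine and_congr_right ?_
    rintro rfl
    exact treeRel_append_iff _

/-! ### Invariants of separative quotients and their completions -/

theorem SepQuot.subsingleton_of_directed {P : Type*} [PartialOrder P]
    (h : ∀ p q : P, ∃ r, r ≤ p ∧ r ≤ q) : Subsingleton (SepQuot P) := by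
  have hle : ∀ p q : P, SepQuot.mk p ≤ SepQuot.mk q := fun p q =>
    SepQuot.mk_le.2 fun r _ => h r q
  refine ⟨fun x y => ?_⟩
  obtain ⟨p, rfl⟩ := SepQuot.mk_surjective x
  obtain ⟨q, rfl⟩ := SepQuot.mk_surjective y
  exact le_antisymm (hle p q) (hle q p)

theorem nonempty_orderIso_of_subsingleton {P Q : Type*} [PartialOrder P] [PartialOrder Q]
    [Subsingleton P] [Subsingleton Q] (p : P) (q : Q) : Nonempty (P ≃o Q) :=
  ⟨{  toFun := fun _ => q
      invFun := fun _ => p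
      left_inv := fun _ => Subsingleton.elim _ _
      right_inv := fun _ => Subsingleton.elim _ _
      map_rel_iff' := fun {a b} => iff_of_true le_rfl (Subsingleton.elim a b).le }⟩

/-- If compatible elements of a partial order are comparable, this passes to its separative
quotient. -/
theorem SepQuot.comparable_of_compatible {P : Type*} [PartialOrder P]
    (h : ∀ p q r : P, r ≤ p → r ≤ q → p ≤ q ∨ q ≤ p) (x y z : SepQuot P) (hx : z ≤ x)
    (hy : z ≤ y) : x ≤ y ∨ y ≤ x := by
  obtain ⟨p, rfl⟩ := SepQuot.mk_surjective x
  obtain ⟨q, rfl⟩ := SepQuot.mk_surjective y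
  obtain ⟨r, hp, hq⟩ := SepQuot.exists_le_of_le_mk hx hy
  exact (h p q r hp hq).imp (fun h => SepQuot.mk_mono h) fun h => SepQuot.mk_mono h

theorem RegOpen.eq_bot_or_eq_top_of_subsingleton {P : Type*} [PartialOrder P] [Subsingleton P]
    (U : RegOpen P) : U = ⊥ ∨ U = ⊤ := by
  by_cases h : ∃ p, p ∈ U.val
  · obtain ⟨p, hp⟩ := h
    exact .inr (top_unique fun q _ => Subsingleton.elim p q ▸ hp)
  · exact .inl (bot_unique fun q hq => h ⟨q, hq⟩)

/-- The pseudocomplement of the ideal below `p` is a proper nonzero regular open set, if some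
element is incompatible with `p`. -/
theorem RegOpen.exists_ne_bot_ne_top {P : Type*} [PartialOrder P] {p q : P}
    (h : ∀ r ≤ p, ¬ r ≤ q) : ∃ U : RegOpen P, U ≠ ⊥ ∧ U ≠ ⊤ := by
  refine ⟨⟨(LowerSet.Iic p)ᶜ, Heyting.isRegular_compl _⟩, fun hU => ?_, fun hU => ?_⟩
  · have hq : q ∈ (LowerSet.Iic p)ᶜ := LowerSet.mem_heytingCompl.2 fun r hr hp => h r hp hr
    have hbot : (LowerSet.Iic p)ᶜ = ⊥ := congrArg Heyting.Regular.val hU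
    rw [hbot] at hq
    exact hq
  · have htop : (LowerSet.Iic p)ᶜ = ⊤ := congrArg Heyting.Regular.val hU
    have hp : p ∈ (LowerSet.Iic p)ᶜ := htop ▸ trivial
    exact LowerSet.mem_heytingCompl.1 hp p le_rfl (le_refl p)

theorem subsingleton_sepQuot_path :
    Subsingleton (SepQuot (BinCopies (MarkedPath fun _ => False))) :=
  SepQuot.subsingleton_of_directed fun A B =>
    (binCopies_path_total A B).elim (fun h => ⟨A, le_rfl, h⟩) fun h => ⟨B, h, le_rfl⟩

theorem BinCopies.univ_mem {T : Type*} (τ : T → T → Prop) : Set.univ ∈ BinCopies τ :=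
  ⟨id, ⟨Function.injective_id, fun _ _ => Iff.rfl⟩, Set.range_id⟩

theorem nonempty_sepQuot_path_iso_pointedPath :
    Nonempty (SepQuot (BinCopies (MarkedPath fun _ => False)) ≃o
      SepQuot (BinCopies PointedPath)) := by
  have := subsingleton_sepQuot_path
  have := SepQuot.subsingleton_of_directed binCopies_pointedPath_directed
  exact nonempty_orderIso_of_subsingleton (SepQuot.mk ⟨_, BinCopies.univ_mem _⟩)
    (SepQuot.mk ⟨_, BinCopies.univ_mem _⟩)

theorem isEmpty_binCopies_path_iso_pointedPath :
    ¬ Nonempty (BinCopies (MarkedPath fun _ => False) ≃o BinCopies PointedPath) := by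
  rintro ⟨i⟩
  refine binCopies_pointedPath_not_total fun A B => ?_
  rw [← i.symm.le_iff_le, ← i.symm.le_iff_le (x := B)]
  exact binCopies_path_total _ _

/-- The completion for a path is trivial, whereas a binary tree has incompatible copies. -/
theorem isEmpty_regOpen_path_iso_tree :
    ¬ Nonempty (RegOpen (SepQuot (BinCopies (MarkedPath fun _ => False))) ≃o
      RegOpen (SepQuot (BinCopies TreeRel))) := by
  rintro ⟨i⟩
  have := subsingleton_sepQuot_path
  let c : Bool → BinCopies TreeRel := fun b => ⟨_, _, isBinEmb_append [b], rfl⟩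
  have hc : ∀ D, D ≤ c false → ¬ D ≤ c true := by
    rintro ⟨_, g, _, rfl⟩ h h'
    obtain ⟨s, hs⟩ := h ⟨[], rfl⟩
    obtain ⟨t, ht⟩ := h' ⟨[], rfl⟩
    simpa using congrArg List.getLast? (hs.trans ht.symm)
  obtain ⟨U, hbot, htop⟩ := RegOpen.exists_ne_bot_ne_top
    (p := SepQuot.mk (c false)) (q := SepQuot.mk (c true)) fun r hr hr' => by
      obtain ⟨D, hD, hD'⟩ := SepQuot.exists_le_of_le_mk hr hr'
      exact hc D hD hD'
  rcases RegOpen.eq_bot_or_eq_top_of_subsingleton (i.symm U) with h | h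
  · exact hbot (by rw [← i.apply_symm_apply U, h, i.map_bot])
  · exact htop (by rw [← i.apply_symm_apply U, h, i.map_top])

theorem exists_isBinEmb_tree_twoTrees :
    (∃ g, IsBinEmb TreeRel TwoTreesRel g) ∧ ∃ g, IsBinEmb TwoTreesRel TreeRel g :=
  ⟨⟨_, isBinEmb_prodMk true⟩, ⟨_, isBinEmb_twoTreesRel⟩⟩

/-- Raising the first of two trees to either side yields two copies that are compatible, as
both contain the second tree, but incomparable even in the separative quotient. -/
theorem isEmpty_sepQuot_tree_iso_twoTrees :
    ¬ Nonempty (SepQuot (BinCopies TreeRel) ≃o SepQuot (BinCopies TwoTreesRel)) := by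
  rintro ⟨i⟩
  have hcomp : ∀ x y z : SepQuot (BinCopies TwoTreesRel), z ≤ x → z ≤ y → x ≤ y ∨ y ≤ x := by
    intro x y z hx hy
    rw [← i.symm.le_iff_le, ← i.symm.le_iff_le (x := y)]
    exact SepQuot.comparable_of_compatible binCopies_treeRel_comparable _ _ _
      (i.symm.monotone hx) (i.symm.monotone hy)
  let c : Bool → BinCopies TwoTreesRel := fun b => ⟨_, _, isBinEmb_twoTreesRel_raise [b], rfl⟩
  let d : BinCopies TwoTreesRel :=
    ⟨_, _, (isBinEmb_prodMk true).comp isBinEmb_twoTreesRel, rfl⟩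
  have hd : ∀ b, d ≤ c b := by
    rintro b _ ⟨⟨x, s⟩, rfl⟩
    exact ⟨(true, s ++ [x, x]), by simp⟩
  have hc : ∀ b, ¬ SepQuot.mk (c b) ≤ SepQuot.mk (c !b) := by
    intro b h
    let r : BinCopies TwoTreesRel :=
      ⟨_, _, (isBinEmb_prodMk false).comp ((isBinEmb_append [b]).comp isBinEmb_twoTreesRel), rfl⟩
    have hr : r ≤ c b := by
      rintro _ ⟨⟨x, s⟩, rfl⟩
      exact ⟨(false, s ++ [x, x]), rfl⟩
    obtain ⟨⟨_, g, _, rfl⟩, hs, hs'⟩ := SepQuot.mk_le.1 h r hr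
    obtain ⟨⟨x, s⟩, h₁⟩ := hs ⟨(true, []), rfl⟩
    obtain ⟨⟨y, t⟩, h₂⟩ := hs' ⟨(true, []), rfl⟩
    obtain ⟨rfl, h₃⟩ := Prod.mk.inj (h₂.trans h₁.symm)
    simpa using congrArg List.getLast? h₃
  rcases hcomp _ _ _ (SepQuot.mk_mono (hd false)) (SepQuot.mk_mono (hd true)) with h | h
  · exact hc false h
  · exact hc true h

/-! ### The shape of the diagram -/

/-- The numbers that can be reached along arrows from a given number, itself included. -/
def descendants : Fin 12 → List (Fin 12) :=
  ![[0, 1, 2, 3, 4, 5, 6, 7, 8, 9, 10, 11], [1, 2, 3, 4, 5, 6, 7, 8, 9, 10, 11],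
    [2, 4, 5, 6, 7, 8, 9, 10, 11], [3, 5, 6, 7, 8, 9, 10, 11], [4, 6, 8, 10, 11],
    [5, 6, 7, 8, 9, 10, 11], [6, 8, 10, 11], [7, 8, 9, 10, 11], [8, 10, 11], [9, 10, 11],
    [10, 11], [11]]

/-- The arrows of the diagram, as a list of pairs. -/
def arrowList : List (Fin 12 × Fin 12) :=
  [(0, 1), (1, 2), (1, 3), (2, 4), (2, 5), (3, 5), (4, 6), (5, 6), (5, 7), (6, 8), (7, 8), (7, 9),
    (8, 10), (9, 10), (10, 11)]

theorem arrow_of_mem_arrowList : ∀ r ∈ arrowList, Arrow r.1 r.2 := by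
  simp only [arrowList, List.forall_mem_cons, List.not_mem_nil, false_imp_iff, implies_true,
    and_true]
  exact ⟨.a, .b, .c, .d, .e, .f, .g, .h, .i, .j, .k, .l, .m, .n, .o⟩

theorem Arrow.lt {p q : Fin 12} (ha : Arrow p q) : p < q := by
  cases ha <;> decide

theorem mem_descendants_iff {p q : Fin 12} :
    q ∈ descendants p ↔ Relation.ReflTransGen Arrow p q := by
  constructor
  · have hstep : ∀ p q, q ∈ descendants p →
        q = p ∨ ∃ r ∈ arrowList, r.1 = p ∧ q ∈ descendants r.2 := by decide
    induction p using WellFoundedGT.induction with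
    | ind p ih =>
      intro h
      rcases hstep p q h with rfl | ⟨r, hr, rfl, hq⟩
      · exact .refl
      · have ha := arrow_of_mem_arrowList r hr
        exact .head ha (ih _ ha.lt hq)
  · intro h
    have hrefl : ∀ p, p ∈ descendants p := by decide
    induction h with
    | refl => exact hrefl p
    | tail _ hqr ih =>
      have hstep : ∀ p q r, Arrow q r → q ∈ descendants p → r ∈ descendants p := by
        intro p q r hqr
        cases hqr <;> revert p <;> decide
      exact hstep _ _ _ hqr ih

/-- Every pair of relations not connected in the diagram is separated as soon as the following
seven are. -/
theorem exists_separating_pair : ∀ p q : Fin 12, q ∉ descendants p →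
    ∃ r ∈ ([(1, 0), (2, 3), (3, 4), (4, 9), (7, 6), (9, 8), (11, 10)] : List (Fin 12 × Fin 12)),
      p ∈ descendants r.1 ∧ r.2 ∈ descendants q := by
  decide

theorem realizesDiagram_of_separating {M : Type*} {sim : Fin 12 → M → M → Prop}
    (hsim : ∀ p q, Arrow p q → ∀ x y, sim p x y → sim q x y)
    (hsep : ∀ r ∈ ([(1, 0), (2, 3), (3, 4), (4, 9), (7, 6), (9, 8), (11, 10)] :
      List (Fin 12 × Fin 12)), ∃ x y, sim r.1 x y ∧ ¬ sim r.2 x y) :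
    RealizesDiagram sim := by
  have htrans : ∀ p q, q ∈ descendants p → ∀ x y, sim p x y → sim q x y := by
    intro p q hpq x y hp
    induction mem_descendants_iff.1 hpq with
    | refl => exact hp
    | tail h hqr ih => exact hsim _ _ hqr _ _ (ih (mem_descendants_iff.2 h))
  have hall : ∀ p q, (∀ x y, sim p x y → sim q x y) → Relation.ReflTransGen Arrow p q := by
    intro p q h
    by_contra hpq
    obtain ⟨r, hr, hp, hq⟩ := exists_separating_pair p q (mt mem_descendants_iff.1 hpq)
    obtain ⟨x, y, h₁, h₂⟩ := hsep r hr
    exact h₂ (htrans _ _ hq x y (h x y (htrans _ _ hp x y h₁)))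
  refine ⟨hsim, fun p q hpq => ?_, hall⟩
  by_contra! h
  have hle : ∀ p q, q ∈ descendants p → p ≤ q := by decide
  exact hpq.lt.not_ge (hle q p (mem_descendants_iff.2 (hall q p h)))

/-! ### The separating pairs of structures -/

theorem ModSim.exists_separating {L : FirstOrder.Language.{u, v}} {X : Type w}
    (D : RealizeData L X) :
    ∀ r ∈ ([(1, 0), (2, 3), (3, 4), (4, 9), (7, 6), (9, 8), (11, 10)] : List (Fin 12 × Fin 12)),
      ∃ ρ σ, ModSim L X r.1 ρ σ ∧ ¬ ModSim L X r.2 ρ σ := by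
  simp only [List.forall_mem_cons, List.not_mem_nil, false_imp_iff, implies_true, and_true]
  refine ⟨?_, ?_, ?_, ?_, ?_, ?_, ?_⟩
  · -- an edge on two points and its reverse
    refine ⟨D.realize (edge false true), D.realize (edge true false), ⟨?_, ?_⟩, fun h => ?_⟩
    · rw [D.copies_realize_eq_iff (not_edge_self (by decide)) (not_edge_self (by decide)),
        binCopies_of_finite, binCopies_of_finite]
    · rw [D.isoStr_realize_iff (not_edge_self (by decide))]
      exact ⟨not, isBinEmb_edge_iff.2 ⟨Bool.not_injective, rfl, rfl⟩, Bool.not_surjective⟩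
    · have h' := congrFun (congrFun (D.realize_injective h) false) true
      have h'' : edge true false false true := h' ▸ ⟨rfl, rfl⟩
      exact Bool.false_ne_true h''.1
  · refine ⟨D.realize (MarkedPath Even), D.realize (MarkedPath Odd), ⟨?_, ?_⟩, fun h => ?_⟩
    · rw [D.copies_realize_eq_iff (not_markedPath_self _) (not_markedPath_self _)]
      exact binCopies_markedPath_even_odd
    · rw [D.equimorphicStr_realize_iff (not_markedPath_self _) (not_markedPath_self _)]
      exact exists_isBinEmb_markedPath_even_odd
    · exact not_exists_iso_markedPath_even_odd
        ((D.isoStr_realize_iff (not_markedPath_self _)).1 h)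
  · refine ⟨D.realize (edge 0 1 : ℕ → ℕ → Prop), D.realize (edge 0 2 : ℕ → ℕ → Prop), ?_,
      fun h => ?_⟩
    · refine (D.isoStr_realize_iff (not_edge_self (by decide))).2 ⟨Equiv.swap 1 2, ?_, ?_⟩
      · exact isBinEmb_edge_iff.2 ⟨(Equiv.swap 1 2).injective, rfl, rfl⟩
      · exact (Equiv.swap 1 2).surjective
    · exact binCopies_edge_ne ((D.copies_realize_eq_iff (not_edge_self (by decide))
        (not_edge_self (by decide))).1 h)
  · -- an edge on two points and the empty relation
    have hemp : ∀ t : Bool, ¬ (fun _ _ : Bool => False) t t := fun _ => id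
    refine ⟨D.realize (edge false true), D.realize fun _ _ : Bool => False, ?_, fun h => ?_⟩
    · refine (D.copies_realize_eq_iff (not_edge_self (by decide)) hemp).2 ?_
      rw [binCopies_of_finite, binCopies_of_finite]
    · obtain ⟨⟨g, hg⟩, -⟩ :=
        (D.equimorphicStr_realize_iff (not_edge_self (by decide)) hemp).1 h
      exact (hg.2 false true).2 ⟨rfl, rfl⟩
  · have hp := not_markedPath_self fun _ => False
    refine ⟨D.realize (MarkedPath fun _ => False), D.realize PointedPath, ⟨?_, ?_⟩, fun h => ?_⟩
    · exact (D.isoSq_realize_iff hp not_pointedPath_self).2 nonempty_sepQuot_path_iso_pointedPath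
    · exact (D.equimorphicStr_realize_iff hp not_pointedPath_self).2
        exists_isBinEmb_path_pointedPath
    · exact isEmpty_binCopies_path_iso_pointedPath
        ((D.isoPoset_realize_iff hp not_pointedPath_self).1 h)
  · refine ⟨D.realize TreeRel, D.realize TwoTreesRel, ?_, fun h => ?_⟩
    · exact (D.equimorphicStr_realize_iff not_treeRel_self not_twoTreesRel_self).2
        exists_isBinEmb_tree_twoTrees
    · exact isEmpty_sepQuot_tree_iso_twoTrees
        ((D.isoSq_realize_iff not_treeRel_self not_twoTreesRel_self).1 h)
  · refine ⟨D.realize (MarkedPath fun _ => False), D.realize TreeRel, trivial, fun h => ?_⟩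
    exact isEmpty_regOpen_path_iso_tree
      ((D.isoRoSq_realize_iff (not_markedPath_self _) not_treeRel_self).1 h)

/-- The language with a single relation symbol, which is binary. -/
def binLanguage : FirstOrder.Language.{u, v} where
  Functions _ := PEmpty
  Relations n := {_x : PUnit.{v + 1} // n = 2}

theorem theorem3p9 :
    (∀ (L : FirstOrder.Language.{u, v}), L.IsRelational → IsEmpty (L.Relations 0) → ¬ L.IsUnary →
      ∀ (κ : Cardinal.{w}), Cardinal.aleph0 ≤ κ →
      ∀ (X : Type w), Cardinal.mk X = κ → RealizesDiagram (ModSim L X)) ∧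
    RealizesDiagram RelStr.Sim.{u, v, w} := by
  constructor
  · rintro L hL h0 hun κ hκ X rfl
    have : Infinite X := Cardinal.infinite_iff.2 hκ
    obtain ⟨n, hn, ⟨R⟩⟩ : ∃ n, n ≠ 1 ∧ Nonempty (L.Relations n) := by
      simpa [FirstOrder.Language.IsUnary] using hun
    obtain ⟨m, rfl⟩ : ∃ m, n = m + 2 := by
      rcases n with _ | _ | m
      · exact (h0.false R).elim
      · exact (hn rfl).elim
      · exact ⟨m, rfl⟩
    obtain ⟨D⟩ := RealizeData.nonempty_of_infinite hL R X
    exact realizesDiagram_of_separating (fun _ _ hpq _ _ => ModSim.of_arrow hL hpq)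
      (ModSim.exists_separating D)
  · have hL : binLanguage.{u, v}.IsRelational := fun _ => inferInstanceAs (IsEmpty PEmpty)
    have h0 : IsEmpty (binLanguage.{u, v}.Relations 0) := ⟨fun R => by simpa using R.2⟩
    obtain ⟨D⟩ := RealizeData.nonempty_of_infinite hL (m := 0) ⟨PUnit.unit, rfl⟩ (ULift.{w} ℕ)
    refine realizesDiagram_of_separating (fun _ _ hpq _ _ => RelStr.Sim.of_arrow hpq) fun r hr => ?_
    obtain ⟨ρ, σ, h₁, h₂⟩ := ModSim.exists_separating D r hr
    have hne : Nonempty (ULift.{w} ℕ) := inferInstance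
    exact ⟨_, _, (RelStr.sim_mk_iff hL h0 hne _ ρ σ).2 h₁,
      fun h => h₂ ((RelStr.sim_mk_iff hL h0 hne _ ρ σ).1 h)⟩
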